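/- For a connected open set $\Omega\subset\mathbf C$ let $\mathrm{SH}_0(\Omega)$ be the class of (upper semicontinuous, $[-\infty,\infty)$-valued, not identically $-\infty$) subharmonic functions $V$ in $\Omega$ such that the support $\mathrm{supp}(\Delta V)$ of the distributional Laplacian has Lebesgue measure $0$. A function $V\in\mathrm{SH}_0(\Omega)$ is a *subharmonic configuration* of harmonic functions $H_1,\dots,H_k$ in $\Omega$ if for every connected component $U$ of $\Omega\setminus\mathrm{supp}(\Delta V)$ there is a $j$ with $V=H_j$ in $U$. For $r>0$ put $D(r)=\{|z|<r\}$, $D_+(r)=\{z=x+iy\in D(r): y>0\}$, $D_-(r)=\{z=x+iy\in D(r): y<0\}$. Let $k\ge 2$, $R>0$, and let $H_1,\dots,H_k$ be harmonic functions in $D(R)$ with $H_\nu(0)=0$ and $\nabla H_\nu(0)=(b_\nu,0)$ for all $\nu$, where $b_1<\dots<b_k$. **(a)** Let $V$ be a subharmonic configuration of $H_1,\dots,H_k$ in $D(R)$. For $\nu\in\{1,k\}$ let $U_\nu$ be the open set of points of $D(R)\setminus\mathrm{supp}(\Delta V)$ in a neighbourhood of which $V=H_\nu$, and suppose that $0\in\overline{U_1}$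 and $0\in\overline{U_k}$. Then there exist integers $m,n\ge 2$, sequences of indices $1=j_1^+<\dots<j_m^+=k$ and $1=j_1^-<\dots<j_n^-=k$, and some $\delta\in(0,R]$ such that $$V=\max(H_{j_1^+},\dots,H_{j_m^+})\ \text{ in } D_+(\delta),\qquad V=\max(H_{j_1^-},\dots,H_{j_n^-})\ \text{ in } D_-(\delta).$$ **(b)** Conversely, for all integers $m,n\ge2$ and all sequences $1=j_1^+<\dots<j_m^+=k$ and $1=j_1^-<\dots<j_n^-=k$ there exist $\delta\in(0,R]$ and a subharmonic configuration $V$ of $H_1,\dots,H_k$ in $D(\delta)$ that is given by these two maxima in $D_+(\delta)$ and $D_-(\delta)$, and for which $0\in\overline{U_1}$ and $0\in\overline{U_k}$ (with $U_1,U_k$ now defined in $D(\delta)$). -/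

import Mathlib

open Set Filter Topology MeasureTheory Metric
open scoped ENNReal Distributions Laplacian

noncomputable section

namespace SubharmonicConfiguration

/-- The mean over the circle `|w - c| = r` of a function with values in `[-∞, ∞]`, as the mean of
the positive part minus the mean of the negative part. For an upper semicontinuous function that
omits `+∞` on the circle the first mean is finite, so the difference is the usual Lebesgue
integral with values in `[-∞, ∞)`. -/
def circleMean (V : ℂ → EReal) (c : ℂ) (r : ℝ) : EReal :=
  (((∫⁻ t in Ioc 0 (2 * Real.pi), (V (circleMap c r t)).toENNReal)
      / ENNReal.ofReal (2 * Real.pi) : ℝ≥0∞) : EReal)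
    - (((∫⁻ t in Ioc 0 (2 * Real.pi), (-V (circleMap c r t)).toENNReal)
      / ENNReal.ofReal (2 * Real.pi) : ℝ≥0∞) : EReal)

/-- `V` is subharmonic in the connected open set `Ω`, with values in `[-∞, ∞)`: upper
semicontinuous, satisfying the local submean inequality, and not identically `-∞`.
The values of `V` outside `Ω` are irrelevant. -/
structure SubharmonicOn (V : ℂ → EReal) (Ω : Set ℂ) : Prop where
  upperSemicontinuousOn : UpperSemicontinuousOn V Ω
  ne_top : ∀ z ∈ Ω, V z ≠ ⊤
  submean : ∀ z ∈ Ω, ∃ ρ > 0, closedBall z ρ ⊆ Ω ∧ ∀ r ∈ Ioc 0 ρ, V z ≤ circleMean V z r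
  exists_ne_bot : ∃ z ∈ Ω, V z ≠ ⊥

/-- The distributional Laplacian of `V` in `Ω`, as a functional on test functions:
`φ ↦ ∫ V Δφ`. -/
def laplacianFunctional (V : ℂ → EReal) (Ω : TopologicalSpace.Opens ℂ) (φ : 𝓓(Ω, ℝ)) : ℝ :=
  ∫ w, (V w).toReal * (Δ (φ : ℂ → ℝ)) w

/-- The support of the distributional Laplacian of `V` in `Ω`, a relatively closed subset
of `Ω`. -/
def laplacianSupport (V : ℂ → EReal) (Ω : TopologicalSpace.Opens ℂ) : Set ℂ :=
  Distribution.dsupport (laplacianFunctional V Ω) ∩ Ω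

/-- The class `SH₀(Ω)`: subharmonic functions in `Ω` whose Laplacian is supported by a Lebesgue
null set. -/
structure MemSH₀ (V : ℂ → EReal) (Ω : TopologicalSpace.Opens ℂ) : Prop where
  subharmonicOn : SubharmonicOn V Ω
  volume_support : volume (laplacianSupport V Ω) = 0

/-- `V` is a subharmonic configuration in `Ω` of the tuple `H` of harmonic functions in `Ω`:
`V ∈ SH₀(Ω)`, and in every connected component of the complement of the support of its Laplacian
`V` agrees with one of the functions `H j`. -/
structure IsSubharmonicConfiguration {k : ℕ} (V : ℂ → EReal) (H : Fin k → ℂ → ℝ)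
    (Ω : TopologicalSpace.Opens ℂ) : Prop where
  harmonic : ∀ j, InnerProductSpace.HarmonicOnNhd (H j) Ω
  memSH₀ : MemSH₀ V Ω
  piecewise : ∀ z ∈ (Ω : Set ℂ) \ laplacianSupport V Ω, ∃ j,
    ∀ w ∈ connectedComponentIn ((Ω : Set ℂ) \ laplacianSupport V Ω) z, V w = (H j w : EReal)

/-- The open set of points of `Ω` off the support of the Laplacian of `V` near which `V`
coincides with `h`. For a configuration of distinct harmonic functions and `h` one of them, it is
the union of those components of the complement of the support in which `V = h`. -/
def activeSet (V : ℂ → EReal) (h : ℂ → ℝ) (Ω : TopologicalSpace.Opens ℂ) : Set ℂ :=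
  {z ∈ (Ω : Set ℂ) \ laplacianSupport V Ω | ∀ᶠ w in 𝓝 z, V w = (h w : EReal)}

/-- The sequence `j` of length `m ≥ 2` increases strictly from the first to the last index of a
`k`-tuple. (Indices in `Fin k` and positions in `Fin m` are counted from `0`.) -/
structure IsIndexSequence {k m : ℕ} (j : Fin m → Fin k) : Prop where
  two_le : 2 ≤ m
  strictMono : StrictMono j
  first : ∀ i : Fin m, (i : ℕ) = 0 → (j i : ℕ) = 0
  last : ∀ i : Fin m, (i : ℕ) + 1 = m → (j i : ℕ) + 1 = k

/-- The open disk of radius `r` centred at the origin. -/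
def disk (r : ℝ) : TopologicalSpace.Opens ℂ := ⟨ball 0 r, isOpen_ball⟩

/-- The open upper half-disk. -/
def upperHalfDisk (r : ℝ) : Set ℂ := {z | z ∈ ball 0 r ∧ 0 < z.im}

/-- The open lower half-disk. -/
def lowerHalfDisk (r : ℝ) : Set ℂ := {z | z ∈ ball 0 r ∧ z.im < 0}

/-- The pointwise maximum of the functions `H (j i)`, over a finite nonempty range of `i`. -/
def maxAlong {k m : ℕ} (H : Fin k → ℂ → ℝ) (j : Fin m → Fin k) (z : ℂ) : ℝ :=
  ⨆ i, H (j i) z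

end SubharmonicConfiguration

end

namespace SubharmonicConfiguration

open InnerProductSpace

/-! For `i < j` the difference `H j - H i` vanishes at `0` and has gradient `(b j - b i, 0)` with `b
j > b i`. So in a small rectangle it increases strictly in `x`, and its zero set is a curve meeting
each horizontal line exactly once. By analyticity two such curves either coincide or meet only at
`0` (`zero_set_dichotomy`). Above the real axis the distinct curves are therefore linearly ordered,
and they cut the strip into connected cells on which all `H j` are distinct. The same holds below.

For (a): `V` takes only values of the `H j`, even on the support of its Laplacian, and equals a
single `H j` in each cell. At a point other than `0` only one curve passes. If `V` is `H α` to its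
left and `H β` to its right, the maximum principle forces `H α = H β` there and `α ≤ β`; otherwise
`V` would be locally the smaller of two harmonic functions and touch one of them from below
(`exists_germs`). Thus indices do not decrease along horizontal lines. Since differences grow with
`x`, `V` majorizes every `H j` that occurs in the half-strip, and so is their maximum
(`isGreatest`). The cells to the left and to the right of all curves cross the real axis, so both
half-strips have the same least and the same greatest index (`exists_extreme`); the hypothesis on
the two closures identifies these as the first and the last.

For (b): on the real axis both maxima equal the first function for `x ≤ 0` and the last for `x ≥ 0`.
The glued function is therefore continuous and near every point majorizes some `H j` that it equals
there, which gives the submean inequality. Off the support of the Laplacian a minimum principle for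
continuous functions with vanishing distributional Laplacian turns this contact into local equality.
-/

/-! ### Submean inequality, maximum principle, and the values of a configuration -/

theorem circleMean_mono {V W : ℂ → EReal} {c : ℂ} {r : ℝ}
    (h : ∀ᵐ t ∂volume.restrict (Ioc 0 (2 * Real.pi)), V (circleMap c r t) ≤ W (circleMap c r t)) :
    circleMean V c r ≤ circleMean W c r := by
  unfold circleMean
  apply EReal.sub_le_sub
  · rw [EReal.coe_ennreal_le_coe_ennreal_iff]
    refine ENNReal.div_le_div_right (lintegral_mono_ae ?_) _
    filter_upwards [h] with t ht using EReal.toENNReal_le_toENNReal ht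
  · rw [EReal.coe_ennreal_le_coe_ennreal_iff]
    refine ENNReal.div_le_div_right (lintegral_mono_ae ?_) _
    filter_upwards [h] with t ht using EReal.toENNReal_le_toENNReal (EReal.neg_le_neg_iff.2 ht)

theorem circleMean_coe {u : ℂ → ℝ} {c : ℂ} {r : ℝ} (hu : CircleIntegrable u c r) :
    circleMean (fun z => (u z : EReal)) c r = ((Real.circleAverage u c r : ℝ) : EReal) := by
  have hpi : 0 < 2 * Real.pi := by positivity
  have hi : Integrable (fun t => u (circleMap c r t)) (volume.restrict (Ioc 0 (2 * Real.pi))) :=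
    (intervalIntegrable_iff_integrableOn_Ioc_of_le hpi.le).1 hu
  have h1 := hi.lintegral_lt_top
  have h2 := hi.neg.lintegral_lt_top
  unfold circleMean
  rw [Real.circleAverage_def, intervalIntegral.integral_of_le hpi.le,
    integral_eq_lintegral_pos_part_sub_lintegral_neg_part hi]
  simp only [← EReal.coe_neg, EReal.toENNReal_of_ne_top (EReal.coe_ne_top _), EReal.toReal_coe]
  simp only [Pi.neg_apply] at h2
  set A := ∫⁻ t in Ioc 0 (2 * Real.pi), ENNReal.ofReal (u (circleMap c r t))
  set B := ∫⁻ t in Ioc 0 (2 * Real.pi), ENNReal.ofReal (-u (circleMap c r t))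
  have key : ∀ X : ℝ≥0∞, X < ⊤ → ((X / ENNReal.ofReal (2 * Real.pi) : ℝ≥0∞) : EReal)
      = ((X.toReal / (2 * Real.pi) : ℝ) : EReal) := by
    intro X hX
    have hne : X / ENNReal.ofReal (2 * Real.pi) ≠ ⊤ :=
      ENNReal.div_ne_top hX.ne (by simpa using Real.pi_pos)
    rw [← ENNReal.ofReal_toReal hne, EReal.coe_ennreal_ofReal, ENNReal.toReal_div,
      ENNReal.toReal_ofReal hpi.le, max_eq_left (by positivity)]
  rw [key A h1, key B h2, ← EReal.coe_sub, smul_eq_mul]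
  congr 1
  field_simp

/-- Fubini in polar coordinates. It makes almost-everywhere information usable in the submean
inequality, which only sees circles. -/
theorem ae_circle_of_ae {P : ℂ → Prop} (z : ℂ) (h : ∀ᵐ w, P w) :
    ∀ᵐ r : ℝ, 0 < r →
      ∀ᵐ t ∂volume.restrict (Ioc 0 (2 * Real.pi)), P (circleMap z r t) := by
  -- The reflection `w ↦ z - w` moves the origin of polar coordinates to `z`. Since `-exp (i(t - π))
  -- = exp (it)`, it also matches the angles `(-π, π)` of `polarCoord` with the range `(0, 2π)` of
  -- `circleMap`.
  have h' : ∀ᵐ w : ℂ, P (z - w) :=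
    (Measure.measurePreserving_sub_left volume z).quasiMeasurePreserving.ae h
  obtain ⟨S, hS, hSm, hS0⟩ := exists_measurable_superset_of_null (ae_iff.1 h')
  have h0 : ∫⁻ w, S.indicator (fun _ => (1 : ℝ≥0∞)) w = 0 := by
    rw [lintegral_indicator_const hSm, hS0, mul_zero]
  rw [← Complex.lintegral_comp_polarCoord_symm] at h0
  have hm : Measurable fun p : ℝ × ℝ => ENNReal.ofReal p.1 •
      S.indicator (fun _ => (1 : ℝ≥0∞)) (Complex.polarCoord.symm p) := by
    have hc : Measurable fun p : ℝ × ℝ => Complex.polarCoord.symm p := by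
      simp only [Complex.polarCoord_symm_apply]
      fun_prop
    exact (by fun_prop : Measurable fun p : ℝ × ℝ => ENNReal.ofReal p.1).smul
      ((measurable_const.indicator hSm).comp hc)
  rw [lintegral_eq_zero_iff hm, polarCoord_target, Measure.volume_eq_prod,
    ← Measure.prod_restrict] at h0
  have h1 := Measure.ae_ae_of_ae_prod h0
  rw [ae_restrict_iff' measurableSet_Ioi] at h1
  filter_upwards [h1] with r hr hr0
  have hr1 := hr hr0
  rw [ae_restrict_iff' measurableSet_Ioo] at hr1
  have hr2 := (MeasureTheory.measurePreserving_sub_right volume Real.pi).quasiMeasurePreserving.ae hr1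
  rw [← Measure.restrict_congr_set Ioo_ae_eq_Ioc, ae_restrict_iff' measurableSet_Ioo]
  filter_upwards [hr2] with t ht htI
  have h3 := ht ⟨by linarith [htI.1], by linarith [htI.2]⟩
  by_contra hP
  have h4 : Complex.polarCoord.symm (r, t - Real.pi) ∈ S := by
    apply hS
    have : z - Complex.polarCoord.symm (r, t - Real.pi) = circleMap z r t := by
      rw [Complex.polarCoord_symm_apply, circleMap, Complex.exp_mul_I]
      simp only [Real.cos_sub_pi, Real.sin_sub_pi, Complex.ofReal_neg, Complex.ofReal_cos,
        Complex.ofReal_sin]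
      ring
    rw [mem_ofPred_eq, this]
    exact hP
  rw [indicator_of_mem h4] at h3
  simp [not_le.2 hr0] at h3

/-- There are arbitrarily small circles around `z` on which the bound holds almost everywhere; there
`f < c` for any given `c > f z`, so the submean inequality yields `V z ≤ c`. -/
theorem SubharmonicOn.le_of_ae_le {V : ℂ → EReal} {Ω : Set ℂ} (hV : SubharmonicOn V Ω) {z : ℂ}
    (hz : z ∈ Ω) {f : ℂ → ℝ} (hf : ContinuousAt f z) {U : Set ℂ} (hU : U ∈ 𝓝 z)
    (h : ∀ᵐ w, w ∈ U → V w ≤ f w) : V z ≤ f z := by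
  refine EReal.le_of_forall_lt_iff_le.1 fun c hc => ?_
  have hc' : f z < c := by exact_mod_cast hc
  obtain ⟨ρ, hρ, -, hm⟩ := hV.submean z hz
  obtain ⟨η, hη, hηU⟩ := Metric.mem_nhds_iff.1 (inter_mem hU (hf.eventually (gt_mem_nhds hc')))
  have h1 := ae_circle_of_ae z h
  have h2 : ∃ r ∈ Ioo 0 (min ρ η), 0 < r →
      ∀ᵐ t ∂volume.restrict (Ioc 0 (2 * Real.pi)), circleMap z r t ∈ U →
        V (circleMap z r t) ≤ f (circleMap z r t) := by
    have : volume (Ioo 0 (min ρ η)) ≠ 0 := by simp [hρ, hη]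
    obtain ⟨r, hr, hr'⟩ := (frequently_ae_mem_iff.2 this).and_eventually h1 |>.exists
    exact ⟨r, hr, hr'⟩
  obtain ⟨r, ⟨hr0, hr1⟩, hr⟩ := h2
  have h3 := hm r ⟨hr0, (hr1.trans_le (min_le_left _ _)).le⟩
  have h4 : circleMean V z r ≤ circleMean (fun _ => (c : EReal)) z r := by
    apply circleMean_mono
    filter_upwards [hr hr0] with t ht
    have hb : circleMap z r t ∈ ball z η := by
      rw [mem_ball, dist_eq_norm, circleMap_sub_center]
      simpa [circleMap, abs_of_pos hr0] using hr1.trans_le (min_le_right _ _)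
    refine (ht (hηU hb).1).trans ?_
    exact_mod_cast (hηU hb).2.le
  rw [circleMean_coe (u := fun _ => c) (circleIntegrable_const _ _ _), Real.circleAverage_const] at h4
  exact h3.trans h4

/-- Strong maximum principle. If `V w < u w` at a nearby `w`, semicontinuity gives a gap on an arc
of the circle around `z` through `w`, so the mean of `V` falls strictly below that of `u`, which is
`u z = V z`. -/
theorem SubharmonicOn.eventually_eq_of_le {V : ℂ → EReal} {Ω : Set ℂ} (hV : SubharmonicOn V Ω)
    {z : ℂ} (hz : z ∈ Ω) {u : ℂ → ℝ} (hu : HarmonicAt u z) (heq : V z = u z)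
    (hle : ∀ᶠ w in 𝓝 z, V w ≤ u w) : ∀ᶠ w in 𝓝 z, V w = u w := by
  obtain ⟨ρ, hρ, hρΩ, hm⟩ := hV.submean z hz
  obtain ⟨η, hη, hηU⟩ := Metric.mem_nhds_iff.1
    (inter_mem (inter_mem hle hu.eventually) (ball_mem_nhds z hρ))
  refine Metric.eventually_nhds_iff_ball.2 ⟨η, hη, fun w hw => ?_⟩
  rcases eq_or_ne w z with rfl | hwz
  · exact heq
  have hr0 : 0 < dist w z := dist_pos.2 hwz
  set r := dist w z with hr
  have hsub : closedBall z |r| ⊆ ball z η := by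
    rw [abs_of_pos hr0]; exact closedBall_subset_ball hw
  have hharm : HarmonicOnNhd u (closedBall z |r|) := fun x hx => (hηU (hsub hx)).1.2
  have hsph : sphere z |r| ⊆ closedBall z |r| := sphere_subset_closedBall
  have hucont : ContinuousOn u (sphere z |r|) := hharm.continuousOn.mono hsph
  have huint : CircleIntegrable u z r := hucont.circleIntegrable'
  refine le_antisymm (hηU hw).1.1 (not_lt.1 fun hlt => ?_)
  obtain ⟨c, hVc, hcu⟩ := EReal.lt_iff_exists_real_btwn.1 hlt
  have hcu' : c < u w := by exact_mod_cast hcu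
  set ε := (u w - c) / 2 with hε
  have hε0 : 0 < ε := by linarith
  have hwball : ball z ρ ∈ 𝓝 w := isOpen_ball.mem_nhds (hηU hw).2
  have husc : ∀ᶠ x in 𝓝 w, V x < c := by
    have := hV.upperSemicontinuousOn w (hρΩ (ball_subset_closedBall (hηU hw).2)) c hVc
    rwa [nhdsWithin_eq_nhds.2 (mem_of_superset hwball (ball_subset_closedBall.trans hρΩ))] at this
  have hucw : ContinuousAt u w := ((hηU hw).1.2).1.continuousAt
  have hugt : ∀ᶠ x in 𝓝 w, c + ε < u x := hucw.eventually (lt_mem_nhds (by linarith))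
  obtain ⟨τ, hτ, hτU⟩ := Metric.mem_nhds_iff.1 (inter_mem husc hugt)
  -- A tent of height `1` supported near `w`, where `V < c` and `c + ε < u`. Hence `u - ε • ψ` is a
  -- continuous majorant of `V` on the circle, with mean strictly below `u z`.
  set ψ : ℂ → ℝ := fun x => max 0 (1 - dist x w / τ) with hψ
  have hψc : Continuous ψ := by fun_prop
  have hψint : CircleIntegrable (ε • ψ) z r := (hψc.const_smul ε).continuousOn.circleIntegrable'
  have hle' : circleMean V z r ≤ circleMean (fun x => ((u - ε • ψ) x : ℝ)) z r := by
    apply circleMean_mono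
    refine Eventually.of_forall fun t => ?_
    set x := circleMap z r t
    have hx : x ∈ ball z η := hsub (hsph (circleMap_mem_sphere' z r t))
    by_cases hxw : x ∈ ball w τ
    · have h1 := hτU hxw
      refine h1.1.le.trans ?_
      have h2 : ψ x ≤ 1 := max_le zero_le_one (by
        have : 0 ≤ dist x w / τ := by positivity
        linarith)
      have h3 : c + ε < u x := h1.2
      have h4 : c ≤ (u - ε • ψ) x := by
        simp only [Pi.sub_apply, Pi.smul_apply, smul_eq_mul]
        nlinarith
      exact_mod_cast h4
    · have : ψ x = 0 := by
        refine max_eq_left ?_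
        have : τ ≤ dist x w := by simpa using hxw
        have : 1 ≤ dist x w / τ := (one_le_div hτ).2 this
        linarith
      have h2 : (u - ε • ψ) x = u x := by simp [this]
      rw [h2]
      exact (hηU hx).1.1
  have hrρ : r ≤ ρ := le_of_lt (hηU hw).2
  have hmean := (hm r ⟨hr0, hrρ⟩).trans hle'
  rw [circleMean_coe (huint.sub hψint), Real.circleAverage_sub huint hψint,
    InnerProductSpace.HarmonicOnNhd.circleAverage_eq hharm, heq] at hmean
  have hmean' : u z ≤ u z - Real.circleAverage (ε • ψ) z r := by exact_mod_cast hmean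
  have hpos : 0 < Real.circleAverage (ε • ψ) z r := by
    rw [Real.circleAverage_def, smul_eq_mul]
    refine mul_pos (by positivity) ?_
    obtain ⟨t, ht, htw⟩ : w ∈ circleMap z r '' Ioc 0 (2 * Real.pi) := by
      rw [image_circleMap_Ioc]
      rw [abs_of_pos hr0]
      exact mem_sphere.2 rfl
    refine intervalIntegral.integral_pos (by positivity) ?_ ?_ ⟨t, Ioc_subset_Icc_self ht, ?_⟩
    · exact ((hψc.const_smul ε).comp (continuous_circleMap z r)).continuousOn
    · intro s _
      exact mul_nonneg hε0.le (le_max_left _ _)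
    · rw [htw]
      simp [hψ, hε0]
  linarith

/-- The definition prescribes `V` only off a null set. If `V z` were none of the `H j z`,
semicontinuity would exclude near `z` the `H j` with larger value at `z`. Almost everywhere near `z`
only those with smaller value would remain, and `le_of_ae_le` would make `V z` at most their
maximum. -/
theorem IsSubharmonicConfiguration.exists_eq {k : ℕ} {V : ℂ → EReal} {H : Fin k → ℂ → ℝ}
    {Ω : TopologicalSpace.Opens ℂ} (hV : IsSubharmonicConfiguration V H Ω) {z : ℂ} (hz : z ∈ Ω) :
    ∃ j, V z = H j z := by
  by_contra! hne
  have hΩ : (Ω : Set ℂ) ∈ 𝓝 z := Ω.isOpen.mem_nhds hz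
  have hs := hV.memSH₀.subharmonicOn
  have hc : ∀ j, ContinuousAt (H j) z := fun j => (hV.harmonic j z hz).1.continuousAt
  have hae : ∀ᵐ w, w ∈ (Ω : Set ℂ) → ∃ j, V w = H j w := by
    have h0 : ∀ᵐ w, w ∉ laplacianSupport V Ω := measure_eq_zero_iff_ae_notMem.1
      hV.memSH₀.volume_support
    filter_upwards [h0] with w hw hwΩ
    obtain ⟨j, hj⟩ := hV.piecewise w ⟨hwΩ, hw⟩
    exact ⟨j, hj w (mem_connectedComponentIn ⟨hwΩ, hw⟩)⟩
  have hbig : ∀ᶠ w in 𝓝 z, ∀ j, V z < H j z → V w < H j w := by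
    refine eventually_all.2 fun j => ?_
    by_cases hj : V z < H j z
    · obtain ⟨c, hVc, hcu⟩ := EReal.lt_iff_exists_real_btwn.1 hj
      have hcu' : c < H j z := by exact_mod_cast hcu
      have husc : ∀ᶠ x in 𝓝 z, V x < c := by
        have := hs.upperSemicontinuousOn z hz c hVc
        rwa [nhdsWithin_eq_nhds.2 hΩ] at this
      filter_upwards [husc, (hc j).eventually (lt_mem_nhds hcu')] with w h1 h2 _
      exact h1.trans (by exact_mod_cast h2)
    · exact Eventually.of_forall fun w h => absurd h hj
  classical
  set L : Finset (Fin k) := Finset.univ.filter fun j => (H j z : EReal) < V z with hL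
  have hU := inter_mem hbig hΩ
  have hL' : ∀ᵐ w, w ∈ {w | ∀ j, V z < H j z → V w < H j w} ∩ (Ω : Set ℂ) →
      ∃ j ∈ L, V w = H j w := by
    filter_upwards [hae] with w hw hwU
    obtain ⟨j, hj⟩ := hw hwU.2
    refine ⟨j, ?_, hj⟩
    rcases lt_trichotomy (H j z : EReal) (V z) with h | h | h
    · simpa [hL] using h
    · exact absurd h.symm (hne j)
    · exact absurd hj (hwU.1 j h).ne
  rcases L.eq_empty_or_nonempty with hemp | hLne
  · have : volume ({w | ∀ j, V z < H j z → V w < H j w} ∩ (Ω : Set ℂ)) = 0 := by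
      rw [measure_eq_zero_iff_ae_notMem]
      filter_upwards [hL'] with w hw hwU
      obtain ⟨j, hj, -⟩ := hw hwU
      simp [hemp] at hj
    exact (Measure.measure_pos_of_mem_nhds volume hU).ne' this
  · have hle := hs.le_of_ae_le hz (f := fun w => L.sup' hLne fun j => H j w)
      (ContinuousAt.finset_sup'_apply hLne fun j _ => hc j) hU (by
        filter_upwards [hL'] with w hw hwU
        obtain ⟨j, hj, hjw⟩ := hw hwU
        rw [hjw]
        exact_mod_cast Finset.le_sup' (fun j => H j w) hj)
    obtain ⟨j, hj, hjz⟩ := Finset.exists_mem_eq_sup' hLne fun j => H j z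
    simp only [hjz] at hle
    have : (H j z : EReal) < V z := by simpa [hL] using hj
    exact absurd hle (not_le.2 this)

/-! ### Zero sets of harmonic functions with nonvanishing gradient -/

theorem exists_analyticAt_re_eq {p : ℂ → ℝ} {z : ℂ} (hp : HarmonicAt p z) :
    ∃ F : ℂ → ℂ, AnalyticAt ℂ F z ∧ ∀ᶠ w in 𝓝 z, (F w).re = p w := by
  obtain ⟨r, hr, hrp⟩ := Metric.eventually_nhds_iff_ball.1 hp.eventually
  obtain ⟨F, hF, hFp⟩ := HarmonicOnNhd.exists_analyticOnNhd_ball_re_eq (z := z) (R := r) hrp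
  exact ⟨F, hF z (mem_ball_self hr), Metric.eventually_nhds_iff_ball.2 ⟨r, hr, hFp⟩⟩

/-- The zero set of a harmonic function with nonvanishing gradient at the origin is, near the
origin, either contained in the zero set of another harmonic function or meets it only at `0`. -/
theorem zero_set_dichotomy {p q : ℂ → ℝ} (hp : HarmonicAt p 0) (hq : HarmonicAt q 0)
    (hp0 : p 0 = 0) {b : ℝ} (hb : b ≠ 0) (hg : HasGradientAt p (b : ℂ) 0) :
    (∀ᶠ z in 𝓝 0, p z = 0 → q z = 0) ∨ ∀ᶠ z in 𝓝 0, z ≠ 0 → p z = 0 → q z ≠ 0 := by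
  obtain ⟨F, hF, hFp⟩ := exists_analyticAt_re_eq hp
  have hd : deriv F 0 ≠ 0 := by
    intro h0
    have h1 : HasFDerivAt (fun w => (F w).re) (0 : ℂ →L[ℝ] ℝ) 0 := by
      have hF' : HasDerivAt F 0 0 := by
        simpa only [h0] using hF.differentiableAt.hasDerivAt
      have := Complex.reCLM.hasFDerivAt.comp (0 : ℂ) (hF'.hasFDerivAt.restrictScalars ℝ)
      convert! this using 1
      ext
      simp
    have h2 := (h1.congr_of_eventuallyEq (EventuallyEq.symm hFp)).unique hg.hasFDerivAt
    have h3 := congrArg (fun L : ℂ →L[ℝ] ℝ => L 1) h2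
    simp [hb.symm] at h3
  -- With `p = Re F`, the map `F` is a conformal coordinate in which the zero set of `p` is a
  -- vertical segment. Along it `q` becomes a real-analytic function of one variable, for which
  -- zeros are isolated or fill a neighbourhood.
  set G := HasStrictDerivAt.localInverse F (deriv F 0) 0 hF.hasStrictDerivAt hd with hGdef
  have hG : AnalyticAt ℂ G (F 0) := hF.analyticAt_localInverse hd
  have hGF : ∀ᶠ z in 𝓝 0, G (F z) = z := hF.hasStrictDerivAt.eventually_left_inverse hd
  have hG0 : G (F 0) = 0 := hGF.self_of_nhds
  have hre0 : (F 0).re = 0 := hFp.self_of_nhds.trans hp0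
  have hm : AnalyticAt ℝ (fun t : ℝ => q (G (F 0 + t * Complex.I))) 0 := by
    have h1 : AnalyticAt ℝ (fun t : ℝ => F 0 + t * Complex.I) 0 :=
      analyticAt_const.add ((Complex.ofRealCLM.analyticAt 0).mul analyticAt_const)
    have h2 : AnalyticAt ℝ (fun t : ℝ => G (F 0 + t * Complex.I)) 0 :=
      AnalyticAt.fun_comp (by simpa using hG.restrictScalars) h1
    exact AnalyticAt.fun_comp (by simpa [hG0] using HarmonicAt.analyticAt hq) h2
  have htend : Tendsto (fun z => (F z - F 0).im) (𝓝 0) (𝓝 0) := by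
    have : ContinuousAt (fun z => (F z - F 0).im) 0 :=
      Complex.continuous_im.continuousAt.comp (hF.continuousAt.sub continuousAt_const)
    simpa [ContinuousAt] using this
  have hrep : ∀ z, (F z).re = 0 → F 0 + ((F z - F 0).im : ℝ) * Complex.I = F z := by
    intro z hz
    apply Complex.ext <;> simp [hz, hre0]
  rcases hm.eventually_eq_zero_or_eventually_ne_zero with h | h
  · left
    filter_upwards [htend.eventually h, hFp, hGF] with z h1 h2 h3 h4
    rwa [hrep z (h2.trans h4), h3] at h1
  · right
    rw [eventually_nhdsWithin_iff] at h
    filter_upwards [htend.eventually h, hFp, hGF] with z h1 h2 h3 hz h4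
    have h5 := hrep z (h2.trans h4)
    rw [h5, h3] at h1
    refine h1 fun h6 => hz ?_
    rw [mem_singleton_iff.1 h6] at h5
    rw [← h3, ← h5]
    simpa using hG0

/-! ### The rectangle in which all differences are transverse to horizontal lines -/

/-- The open rectangle `|x| < a`, `|y| < h`. -/
def box (a h : ℝ) : Set ℂ := Ioo (-a) a ×ℂ Ioo (-h) h

theorem isOpen_box (a h : ℝ) : IsOpen (box a h) := isOpen_Ioo.reProdIm isOpen_Ioo

theorem mem_box {a h : ℝ} {z : ℂ} : z ∈ box a h ↔ z.re ∈ Ioo (-a) a ∧ z.im ∈ Ioo (-h) h :=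
  Complex.mem_reProdIm

/-- In the rectangle the differences `H j - H i`, `i < j`, increase strictly along horizontal
lines, vanish at some point of each horizontal line, and the zero sets of any two of them have no
points in common except the origin, or one contains the other. -/
structure IsTransverse {k : ℕ} (H : Fin k → ℂ → ℝ) (a h : ℝ) : Prop where
  pos_left : 0 < a
  pos_right : 0 < h
  harmonic : ∀ j, HarmonicOnNhd (H j) (box a h)
  strictMonoOn : ∀ i j, i < j → ∀ y ∈ Ioo (-h) h,
    StrictMonoOn (fun x => H j ⟨x, y⟩ - H i ⟨x, y⟩) (Ioo (-a) a)
  exists_root : ∀ i j, i < j → ∀ y ∈ Ioo (-h) h, ∃ x ∈ Ioo (-a) a, H j ⟨x, y⟩ = H i ⟨x, y⟩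
  crossing : ∀ i j, i < j → ∀ i' j',
    (∀ z ∈ box a h, H j z = H i z → H j' z = H i' z) ∨
      ∀ z ∈ box a h, z ≠ 0 → H j z = H i z → H j' z ≠ H i' z

theorem hasDerivAt_mk (x y : ℝ) : HasDerivAt (fun x : ℝ => (⟨x, y⟩ : ℂ)) 1 x := by
  have h1 : HasDerivAt (fun x : ℝ => (x : ℂ) + y * Complex.I) 1 x :=
    (Complex.ofRealCLM.hasDerivAt (x := x)).add_const _
  convert! h1 using 1
  funext t
  exact Complex.mk_eq_add_mul_I t y

theorem continuous_mk_left (y : ℝ) : Continuous (fun x : ℝ => (⟨x, y⟩ : ℂ)) :=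
  continuous_iff_continuousAt.2 fun x => (hasDerivAt_mk x y).continuousAt

theorem continuous_mk_right (x : ℝ) : Continuous (fun y : ℝ => (⟨x, y⟩ : ℂ)) := by
  have : (fun y : ℝ => (⟨x, y⟩ : ℂ)) = fun y : ℝ => (x : ℂ) + y * Complex.I := by
    funext t
    exact Complex.mk_eq_add_mul_I x t
  rw [this]
  fun_prop

/-- The `x`-derivative of `H j - H i` is `b j - b i > 0` at `0`, hence positive nearby. The crossing
alternative comes from `zero_set_dichotomy`, and finitely many pairs allow one common neighbourhood.
-/
theorem exists_isTransverse {k : ℕ} {R : ℝ} (hR : 0 < R) {H : Fin k → ℂ → ℝ} {b : Fin k → ℝ}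
    (hH : ∀ ν, HarmonicOnNhd (H ν) (ball 0 R)) (hH0 : ∀ ν, H ν 0 = 0)
    (hgrad : ∀ ν, HasGradientAt (H ν) ((b ν : ℝ) : ℂ) 0) (hb : StrictMono b) :
    ∃ a h, IsTransverse H a h ∧ box a h ⊆ ball 0 R := by
  have h0 : (0 : ℂ) ∈ ball (0 : ℂ) R := mem_ball_self hR
  have hderiv0 : ∀ ν, fderiv ℝ (H ν) 0 1 = b ν := by
    intro ν
    rw [(hgrad ν).hasFDerivAt.fderiv]
    simp
  have hcd : ∀ ν, ContinuousAt (fun z => fderiv ℝ (H ν) z 1) 0 := fun ν =>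
    (((hH ν 0 h0).1.fderiv_right (m := 1) le_rfl).continuousAt).clm_apply continuousAt_const
  have hE1 : ∀ᶠ z in 𝓝 (0 : ℂ), ∀ i j, i < j → fderiv ℝ (H i) z 1 < fderiv ℝ (H j) z 1 := by
    refine eventually_all.2 fun i => eventually_all.2 fun j => ?_
    by_cases hij : i < j
    · have : fderiv ℝ (H i) 0 1 < fderiv ℝ (H j) 0 1 := by
        rw [hderiv0, hderiv0]; exact hb hij
      filter_upwards [(hcd i).eventually_lt (hcd j) this] with z hz _ using hz
    · exact Eventually.of_forall fun z h => absurd h hij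
  have hE2 : ∀ᶠ z in 𝓝 (0 : ℂ), ∀ i j, i < j → ∀ i' j',
      ((∀ᶠ z in 𝓝 (0 : ℂ), H j z = H i z → H j' z = H i' z) →
        H j z = H i z → H j' z = H i' z) ∧
      ((¬ ∀ᶠ z in 𝓝 (0 : ℂ), H j z = H i z → H j' z = H i' z) →
        z ≠ 0 → H j z = H i z → H j' z ≠ H i' z) := by
    refine eventually_all.2 fun i => eventually_all.2 fun j => ?_
    by_cases hij : i < j
    · suffices h : ∀ᶠ z in 𝓝 (0 : ℂ), ∀ i' j', _ from h.mono fun z hz _ => hz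
      refine eventually_all.2 fun i' => eventually_all.2 fun j' => ?_
      by_cases hA : ∀ᶠ z in 𝓝 (0 : ℂ), H j z = H i z → H j' z = H i' z
      · filter_upwards [hA] with z hz using ⟨fun _ => hz, fun h => absurd hA h⟩
      · have hg : HasGradientAt (H j - H i) ((b j - b i : ℝ) : ℂ) 0 := by
          rw [hasGradientAt_iff_hasFDerivAt]
          convert! (hgrad j).hasFDerivAt.sub (hgrad i).hasFDerivAt using 1
          simp
        rcases zero_set_dichotomy ((hH j 0 h0).sub (hH i 0 h0)) ((hH j' 0 h0).sub (hH i' 0 h0))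
          (by simp [hH0]) (sub_ne_zero.2 (hb hij).ne') hg with h | h
        · exact absurd (h.mono fun z hz => by simpa [sub_eq_zero] using hz) hA
        · filter_upwards [h] with z hz
          exact ⟨fun h => absurd h hA, fun _ => by simpa [sub_eq_zero] using hz⟩
    · exact Eventually.of_forall fun z h => absurd h hij
  obtain ⟨ε, hε, hεE⟩ := Metric.eventually_nhds_iff_ball.1
    ((hE1.and hE2).and (ball_mem_nhds (0 : ℂ) hR))
  -- The bound `|x| + |y| < ε` keeps even the vertical sides `x = ±a` inside the good disk; the
  -- signs of the differences are needed there.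
  set a := ε / 2 with ha
  have ha0 : 0 < a := by positivity
  have hin : ∀ x y : ℝ, |x| ≤ a → |y| < a → (⟨x, y⟩ : ℂ) ∈ ball (0 : ℂ) ε := by
    intro x y hx hy
    rw [mem_ball_zero_iff]
    calc ‖(⟨x, y⟩ : ℂ)‖ ≤ |x| + |y| := Complex.norm_le_abs_re_add_abs_im _
      _ < ε := by linarith
  have hmono : ∀ i j, i < j → ∀ y, |y| < a →
      StrictMonoOn (fun x => H j ⟨x, y⟩ - H i ⟨x, y⟩) (Icc (-a) a) := by
    intro i j hij y hy
    have hd : ∀ ν, ∀ x ∈ Icc (-a) a, HasDerivAt (fun x : ℝ => H ν ⟨x, y⟩)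
        (fderiv ℝ (H ν) ⟨x, y⟩ 1) x := by
      intro ν x hx
      have hz := (hεE _ (hin x y (abs_le.2 hx) hy)).2
      have h1 : HasFDerivAt (H ν) (fderiv ℝ (H ν) ⟨x, y⟩) ⟨x, y⟩ :=
        ((hH ν _ hz).1.differentiableAt (by norm_num)).hasFDerivAt
      exact h1.comp_hasDerivAt x (hasDerivAt_mk x y)
    refine strictMonoOn_of_deriv_pos (convex_Icc _ _)
      (fun x hx => ((hd j x hx).sub (hd i x hx)).continuousAt.continuousWithinAt) fun x hx => ?_
    have hx' := interior_subset hx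
    have hdd := (hd j x hx').sub (hd i x hx')
    have := (hεE _ (hin x y (abs_le.2 hx') hy)).1.1 i j hij
    rw [show (fun x => H j ⟨x, y⟩ - H i ⟨x, y⟩) =
      (fun x : ℝ => H j ⟨x, y⟩) - fun x : ℝ => H i ⟨x, y⟩ from rfl, hdd.deriv]
    linarith
  have hz0 : (⟨0, 0⟩ : ℂ) = 0 := rfl
  have hcy : ∀ ν, ∀ x, |x| ≤ a → ContinuousAt (fun y : ℝ => H ν ⟨x, y⟩) 0 := fun ν x hx =>
    ContinuousAt.comp (f := fun y : ℝ => (⟨x, y⟩ : ℂ)) (x := (0 : ℝ)) (g := H ν)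
      (hH ν _ (hεE _ (hin x 0 hx (by simpa using ha0))).2).1.continuousAt
      (continuous_mk_right x).continuousAt
  -- For `y = 0` monotonicity and the zero at the origin give opposite signs at `x = ±a`. They
  -- persist for small `|y|`, so the intermediate value theorem applies on each line.
  have hsgn : ∀ᶠ y in 𝓝 (0 : ℝ), ∀ i j, i < j →
      H j ⟨-a, y⟩ < H i ⟨-a, y⟩ ∧ H i ⟨a, y⟩ < H j ⟨a, y⟩ := by
    refine eventually_all.2 fun i => eventually_all.2 fun j => ?_
    by_cases hij : i < j
    · have hm := hmono i j hij 0 (by simpa using ha0)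
      have h1 := hm (left_mem_Icc.2 (by linarith)) (show (0 : ℝ) ∈ Icc (-a) a from
        ⟨by linarith, ha0.le⟩) (by linarith)
      have h2 := hm (show (0 : ℝ) ∈ Icc (-a) a from
        ⟨by linarith, ha0.le⟩) (right_mem_Icc.2 (by linarith)) ha0
      simp only [hz0, hH0, sub_zero] at h1 h2
      have hle : |(-a)| ≤ a := by simp [abs_of_pos ha0]
      have hle' : |a| ≤ a := by simp [abs_of_pos ha0]
      filter_upwards [(hcy j _ hle).eventually_lt (hcy i _ hle) (by linarith),
        (hcy i _ hle').eventually_lt (hcy j _ hle') (by linarith)] with y h3 h4 _ using ⟨h3, h4⟩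
    · exact Eventually.of_forall fun z h => absurd h hij
  obtain ⟨h', hh', hsgn'⟩ := Metric.eventually_nhds_iff_ball.1 hsgn
  have hbox : box a (min h' a) ⊆ ball 0 ε := by
    intro z hz
    obtain ⟨h1, h2⟩ := mem_box.1 hz
    exact hin z.re z.im (abs_lt.2 h1).le ((abs_lt.2 h2).trans_le (min_le_right _ _))
  refine ⟨a, min h' a, ⟨ha0, lt_min hh' ha0, fun j z hz => hH j z (hεE z (hbox hz)).2, ?_, ?_, ?_⟩,
    fun z hz => (hεE z (hbox hz)).2⟩
  · intro i j hij y hy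
    exact (hmono i j hij y ((abs_lt.2 hy).trans_le (min_le_right _ _))).mono Ioo_subset_Icc_self
  · intro i j hij y hy
    have hya : |y| < a := (abs_lt.2 hy).trans_le (min_le_right _ _)
    have hyh : y ∈ ball (0 : ℝ) h' := by
      simpa using (abs_lt.2 hy).trans_le (min_le_left _ _)
    obtain ⟨h1, h2⟩ := hsgn' y hyh i j hij
    have hc : ContinuousOn (fun x => H j ⟨x, y⟩ - H i ⟨x, y⟩) (Icc (-a) a) := by
      have : ∀ ν, ContinuousOn (fun x => H ν ⟨x, y⟩) (Icc (-a) a) := fun ν x hx =>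
        (ContinuousAt.comp (f := fun x : ℝ => (⟨x, y⟩ : ℂ)) (g := H ν)
          (hH ν _ (hεE _ (hin x y (abs_le.2 hx) hya)).2).1.continuousAt
          (continuous_mk_left y).continuousAt).continuousWithinAt
      exact (this j).sub (this i)
    obtain ⟨x, hx, hx0⟩ := intermediate_value_Ioo (by linarith) hc
      (show (0 : ℝ) ∈ Ioo _ _ from ⟨by simpa using h1, by simpa using h2⟩)
    exact ⟨x, hx, sub_eq_zero.1 hx0⟩
  · intro i j hij i' j'
    by_cases hA : ∀ᶠ z in 𝓝 (0 : ℂ), H j z = H i z → H j' z = H i' z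
    · exact Or.inl fun z hz => ((hεE z (hbox hz)).1.2 i j hij i' j').1 hA
    · exact Or.inr fun z hz => ((hεE z (hbox hz)).1.2 i j hij i' j').2 hA

/-! ### Cells between the zero curves -/

/-- The points of the rectangle at which the differences `H j - H i`, `i < j`, have the signs
of `s i j`. -/
def cell {k : ℕ} (H : Fin k → ℂ → ℝ) (a h : ℝ) (s : Fin k → Fin k → ℝ) : Set ℂ :=
  {z ∈ box a h | ∀ i j, i < j → 0 < s i j * (H j z - H i z)}

/-- `Complex.im` is an open map, so two open sets separating the total set project to open sets
covering `I`. Connectedness of `I` gives a line meeting both, and the slice on that line is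
connected. -/
theorem isPreconnected_inter_im_preimage {W : Set ℂ} (hW : IsOpen W) {I : Set ℝ}
    (hI : IsPreconnected I) (hslice : ∀ y ∈ I, IsPreconnected {z ∈ W | z.im = y})
    (hne : ∀ y ∈ I, ∃ z ∈ W, z.im = y) : IsPreconnected (W ∩ Complex.im ⁻¹' I) := by
  rintro u v hu hv huv ⟨z, ⟨hzW, hzI⟩, hzu⟩ ⟨w, ⟨hwW, hwI⟩, hwv⟩
  obtain ⟨y, hyI, ⟨p, ⟨hpW, hpu⟩, hpy⟩, ⟨q, ⟨hqW, hqv⟩, hqy⟩⟩ :=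
    hI _ _ (Complex.isOpenMap_im _ (hW.inter hu)) (Complex.isOpenMap_im _ (hW.inter hv))
      (fun y hy => by
        obtain ⟨x, hxW, rfl⟩ := hne y hy
        rcases huv ⟨hxW, hy⟩ with h | h
        · exact Or.inl ⟨x, ⟨hxW, h⟩, rfl⟩
        · exact Or.inr ⟨x, ⟨hxW, h⟩, rfl⟩)
      ⟨z.im, hzI, z, ⟨hzW, hzu⟩, rfl⟩ ⟨w.im, hwI, w, ⟨hwW, hwv⟩, rfl⟩
  obtain ⟨x, ⟨hxW, hxy⟩, hx⟩ := hslice y hyI u v hu hv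
    (fun x hx => huv ⟨hx.1, by rw [mem_preimage, hx.2]; exact hyI⟩)
    ⟨p, ⟨hpW, hpy⟩, hpu⟩ ⟨q, ⟨hqW, hqy⟩, hqv⟩
  exact ⟨x, ⟨hxW, by rw [mem_preimage, hxy]; exact hyI⟩, hx⟩

section IsTransverse

variable {k : ℕ} {H : Fin k → ℂ → ℝ} {a h : ℝ}

theorem IsTransverse.continuousAt (hT : IsTransverse H a h) (j : Fin k) {z : ℂ}
    (hz : z ∈ box a h) : ContinuousAt (H j) z :=
  (hT.harmonic j z hz).1.continuousAt

theorem IsTransverse.continuousOn_line (hT : IsTransverse H a h) (j : Fin k) {y : ℝ}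
    (hy : y ∈ Ioo (-h) h) : ContinuousOn (fun x => H j ⟨x, y⟩) (Ioo (-a) a) := fun _ hx =>
  (ContinuousAt.comp (f := fun x : ℝ => (⟨x, y⟩ : ℂ)) (g := H j)
    (hT.continuousAt j (mem_box.2 ⟨hx, hy⟩)) (continuous_mk_left y).continuousAt).continuousWithinAt

theorem IsTransverse.isOpen_cell (hT : IsTransverse H a h) (s : Fin k → Fin k → ℝ) :
    IsOpen (cell H a h s) := by
  rw [isOpen_iff_mem_nhds]
  rintro z ⟨hz, hs⟩
  have : ∀ᶠ w in 𝓝 z, ∀ i j, i < j → 0 < s i j * (H j w - H i w) := by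
    refine eventually_all.2 fun i => eventually_all.2 fun j => ?_
    by_cases hij : i < j
    · have hc : ContinuousAt (fun w => s i j * (H j w - H i w)) z :=
        continuousAt_const.mul ((hT.continuousAt j hz).sub (hT.continuousAt i hz))
      filter_upwards [hc.eventually (lt_mem_nhds (hs i j hij))] with w hw _ using hw
    · exact Eventually.of_forall fun z h => absurd h hij
  exact inter_mem ((isOpen_box a h).mem_nhds hz) this

/-- By monotonicity in `x` each sign condition holds on an order-convex part of the line. -/
theorem IsTransverse.isPreconnected_cell_slice (hT : IsTransverse H a h)
    (s : Fin k → Fin k → ℝ) {y : ℝ} (hy : y ∈ Ioo (-h) h) :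
    IsPreconnected {z ∈ cell H a h s | z.im = y} := by
  have himg : {z ∈ cell H a h s | z.im = y} =
      (fun x : ℝ => (⟨x, y⟩ : ℂ)) '' {x | (⟨x, y⟩ : ℂ) ∈ cell H a h s} := by
    ext z
    constructor
    · rintro ⟨hz, rfl⟩
      exact ⟨z.re, hz, rfl⟩
    · rintro ⟨x, hx, rfl⟩
      exact ⟨hx, rfl⟩
  rw [himg]
  refine IsPreconnected.image ?_ _ (continuous_mk_left y).continuousOn
  refine OrdConnected.isPreconnected ⟨?_⟩
  rintro p ⟨hp, hp'⟩ q ⟨hq, hq'⟩ x ⟨hpx, hxq⟩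
  have hpa := (mem_box.1 hp).1
  have hqa := (mem_box.1 hq).1
  have hxa : x ∈ Ioo (-a) a := ⟨hpa.1.trans_le hpx, hxq.trans_lt hqa.2⟩
  refine ⟨mem_box.2 ⟨hxa, hy⟩, fun i j hij => ?_⟩
  have hm := (hT.strictMonoOn i j hij y hy).monotoneOn
  have h1 := hm hpa hxa hpx
  have h2 := hm hxa hqa hxq
  have h3 := hp' i j hij
  have h4 := hq' i j hij
  simp only at h1 h2
  rcases le_total 0 (s i j) with hs | hs
  · exact h3.trans_le (mul_le_mul_of_nonneg_left h1 hs)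
  · exact h4.trans_le (mul_le_mul_of_nonpos_left h2 hs)

/-- A cell is connected if all its slices are nonempty. -/
theorem IsTransverse.isPreconnected_cell (hT : IsTransverse H a h) (s : Fin k → Fin k → ℝ)
    {I : Set ℝ} (hI : IsPreconnected I) (hIh : I ⊆ Ioo (-h) h)
    (hne : ∀ y ∈ I, ∃ z ∈ cell H a h s, z.im = y) :
    IsPreconnected (cell H a h s ∩ Complex.im ⁻¹' I) :=
  isPreconnected_inter_im_preimage (hT.isOpen_cell s) hI
    (fun _ hy => hT.isPreconnected_cell_slice s (hIh hy)) hne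

theorem cell_injective {s : Fin k → Fin k → ℝ} {z : ℂ} (hz : z ∈ cell H a h s) {i j : Fin k}
    (hij : H i z = H j z) : i = j := by
  rcases lt_trichotomy i j with hlt | heq | hlt
  · have := hz.2 i j hlt
    simp [hij] at this
  · exact heq
  · have := hz.2 j i hlt
    simp [hij] at this

/-- In a cell the `H j` are pairwise distinct, so the local index of `v` is well defined and locally
constant, hence constant. -/
theorem IsTransverse.eq_of_mem_cell (hT : IsTransverse H a h) {v : ℂ → ℝ}
    (hv : ∀ z ∈ box a h, (∀ i j, H i z = H j z → i = j) → ∃ j, ∀ᶠ w in 𝓝 z, v w = H j w)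
    (s : Fin k → Fin k → ℝ) {I : Set ℝ} (hI : IsPreconnected I) (hIh : I ⊆ Ioo (-h) h)
    (hne : ∀ y ∈ I, ∃ z ∈ cell H a h s, z.im = y) {z w : ℂ} (hz : z ∈ cell H a h s)
    (hzI : z.im ∈ I) (hw : w ∈ cell H a h s) (hwI : w.im ∈ I) {j : Fin k} (hj : v z = H j z) :
    v w = H j w := by
  have hloc : ∀ z ∈ cell H a h s, ∃ j, ∀ᶠ w in 𝓝 z, v w = H j w := fun z hz =>
    hv z hz.1 fun _ _ => cell_injective hz
  have : Nonempty (Fin k) := ⟨j⟩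
  choose! ι hι using hloc
  let _ : TopologicalSpace (Fin k) := ⊥
  have : DiscreteTopology (Fin k) := ⟨rfl⟩
  have hc : ContinuousOn ι (cell H a h s ∩ Complex.im ⁻¹' I) := by
    intro x hx
    refine ContinuousAt.continuousWithinAt ?_
    rw [ContinuousAt, nhds_discrete (Fin k), tendsto_pure]
    filter_upwards [hι x hx.1, (hT.isOpen_cell s).mem_nhds hx.1] with t ht hts
    exact cell_injective hts ((hι t hts).self_of_nhds.symm.trans ht)
  have h1 := (hT.isPreconnected_cell s hI hIh hne).constant hc ⟨hz, hzI⟩ ⟨hw, hwI⟩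
  have h2 : j = ι z := cell_injective hz (hj.symm.trans (hι z hz).self_of_nhds)
  rw [h2, h1]
  exact (hι w hw).self_of_nhds

/-- On a horizontal line, a point that is to the right of some of the zeros of the differences
and to the left of the others exists as soon as these are ordered accordingly. -/
theorem IsTransverse.exists_mem_cell (hT : IsTransverse H a h) (s : Fin k → Fin k → ℝ)
    (hs : ∀ i j, i < j → s i j ≠ 0) {y : ℝ} (hy : y ∈ Ioo (-h) h)
    (hsep : ∀ i j, i < j → ∀ i' j', i' < j' → 0 < s i j → s i' j' < 0 →
      ∃ x ∈ Ioo (-a) a, H i ⟨x, y⟩ < H j ⟨x, y⟩ ∧ H j' ⟨x, y⟩ < H i' ⟨x, y⟩) :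
    ∃ z ∈ cell H a h s, z.im = y := by
  classical
  have hroot : ∀ p : Fin k × Fin k, ∃ x, p.1 < p.2 → x ∈ Ioo (-a) a ∧
      H p.2 ⟨x, y⟩ = H p.1 ⟨x, y⟩ := by
    intro p
    by_cases hp : p.1 < p.2
    · obtain ⟨x, hx, hx'⟩ := hT.exists_root p.1 p.2 hp y hy
      exact ⟨x, fun _ => ⟨hx, hx'⟩⟩
    · exact ⟨0, fun h => absurd h hp⟩
  choose γ hγ using hroot
  have hlt : ∀ p : Fin k × Fin k, p.1 < p.2 → ∀ x ∈ Ioo (-a) a,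
      (H p.1 ⟨x, y⟩ < H p.2 ⟨x, y⟩ ↔ γ p < x) ∧ (H p.2 ⟨x, y⟩ < H p.1 ⟨x, y⟩ ↔ x < γ p) := by
    intro p hp x hx
    obtain ⟨h1, h2⟩ := hγ p hp
    have hm := hT.strictMonoOn p.1 p.2 hp y hy
    have h3 := hm.lt_iff_lt h1 hx
    have h4 := hm.lt_iff_lt hx h1
    simp only [h2, sub_self, sub_pos, sub_neg] at h3 h4
    exact ⟨h3, h4⟩
  -- The zeros that must lie to the left of the point, with the left end of the interval added; `hi`
  -- collects those to the right. By `hsep` each element of `lo` is less than each of `hi`.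
  let lo : Finset ℝ := insert (-a)
    ((Finset.univ.filter fun p : Fin k × Fin k => p.1 < p.2 ∧ 0 < s p.1 p.2).image γ)
  let hi : Finset ℝ := insert a
    ((Finset.univ.filter fun p : Fin k × Fin k => p.1 < p.2 ∧ s p.1 p.2 < 0).image γ)
  have ha := hT.pos_left
  obtain ⟨x, hx1, hx2⟩ := Order.exists_between_finsets lo hi (by
    intro x hx x' hx'
    simp only [lo, hi, Finset.mem_insert, Finset.mem_image, Finset.mem_filter, Finset.mem_univ,
      true_and] at hx hx'
    rcases hx with rfl | ⟨p, ⟨hp, hps⟩, rfl⟩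
    · rcases hx' with rfl | ⟨q, ⟨hq, hqs⟩, rfl⟩
      · linarith
      · exact (hγ q hq).1.1
    · rcases hx' with rfl | ⟨q, ⟨hq, hqs⟩, rfl⟩
      · exact (hγ p hp).1.2
      · obtain ⟨x, hx, h1, h2⟩ := hsep p.1 p.2 hp q.1 q.2 hq hps hqs
        exact ((hlt p hp x hx).1.1 h1).trans ((hlt q hq x hx).2.1 h2))
  have hxa : x ∈ Ioo (-a) a :=
    ⟨hx1 _ (Finset.mem_insert_self _ _), hx2 _ (Finset.mem_insert_self _ _)⟩
  refine ⟨⟨x, y⟩, ⟨mem_box.2 ⟨hxa, hy⟩, fun i j hij => ?_⟩, rfl⟩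
  rcases lt_or_gt_of_ne (hs i j hij) with hneg | hpos
  · refine mul_pos_of_neg_of_neg hneg (sub_neg.2 ((hlt (i, j) hij x hxa).2.2 (hx2 _ ?_)))
    exact Finset.mem_insert_of_mem (Finset.mem_image_of_mem _ (by simp [hij, hneg]))
  · refine mul_pos hpos (sub_pos.2 ((hlt (i, j) hij x hxa).1.2 (hx1 _ ?_)))
    exact Finset.mem_insert_of_mem (Finset.mem_image_of_mem _ (by simp [hij, hpos]))

/-- On every horizontal line both differences increase strictly and share their zero, so their signs
agree. -/
theorem IsTransverse.lt_iff_lt_of_zeros (hT : IsTransverse H a h) {i j i' j' : Fin k}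
    (hij : i < j) (hij' : i' < j')
    (hz : ∀ z ∈ box a h, H j z = H i z → H j' z = H i' z) {w : ℂ} (hw : w ∈ box a h) :
    (H i w < H j w ↔ H i' w < H j' w) ∧ (H j w < H i w ↔ H j' w < H i' w) := by
  obtain ⟨hwa, hwh⟩ := mem_box.1 hw
  obtain ⟨x, hx, hx'⟩ := hT.exists_root i j hij w.im hwh
  have h0 := hz ⟨x, w.im⟩ (mem_box.2 ⟨hx, hwh⟩) hx'
  have hm := hT.strictMonoOn i j hij w.im hwh
  have hm' := hT.strictMonoOn i' j' hij' w.im hwh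
  have h1 := hm.lt_iff_lt hx hwa
  have h2 := hm.lt_iff_lt hwa hx
  have h3 := hm'.lt_iff_lt hx hwa
  have h4 := hm'.lt_iff_lt hwa hx
  simp only [hx', h0, sub_self, sub_pos, sub_neg, Complex.eta] at h1 h2 h3 h4
  exact ⟨h1.trans h3.symm, h2.trans h4.symm⟩

/-- The order of two distinct zero curves does not change along an interval avoiding `0`. -/
theorem IsTransverse.exists_sep (hT : IsTransverse H a h) {I : Set ℝ} (hI : IsPreconnected I)
    (hIh : I ⊆ Ioo (-h) h) (hI0 : (0 : ℝ) ∉ I) {i j i' j' : Fin k} (hij : i < j) (hij' : i' < j')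
    {z : ℂ} (hz : z ∈ box a h) (hzI : z.im ∈ I) (h1 : H i z < H j z) (h2 : H j' z < H i' z)
    {y : ℝ} (hy : y ∈ I) :
    ∃ x ∈ Ioo (-a) a, H i ⟨x, y⟩ < H j ⟨x, y⟩ ∧ H j' ⟨x, y⟩ < H i' ⟨x, y⟩ := by
  -- The opposite signs at `z` rule out coinciding curves, so the curves meet at most at `0`, which
  -- is not over `I`.
  have hne : ∀ w ∈ box a h, w.im ∈ I → H j w = H i w → H j' w ≠ H i' w := by
    rcases hT.crossing i j hij i' j' with hc | hc
    · have := ((hT.lt_iff_lt_of_zeros hij hij' hc hz).1.1 h1).trans h2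
      exact absurd this (lt_irrefl _)
    · intro w hw hwI
      refine hc w hw fun h0 => hI0 ?_
      simpa [h0] using hwI
  have hopen : ∀ i j i' j', IsOpen {w ∈ box a h | H i w < H j w ∧ H j' w < H i' w} := by
    intro i j i' j'
    rw [isOpen_iff_mem_nhds]
    rintro w ⟨hw, hw1, hw2⟩
    filter_upwards [(isOpen_box a h).mem_nhds hw,
      (hT.continuousAt i hw).eventually_lt (hT.continuousAt j hw) hw1,
      (hT.continuousAt j' hw).eventually_lt (hT.continuousAt i' hw) hw2] with t h3 h4 h5
    exact ⟨h3, h4, h5⟩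
  by_contra hcon
  -- On each line the two zeros differ, and their midpoint shows which one comes first. Both orders
  -- are open conditions on the line, so if both occurred, connectedness of `I` would make them hold
  -- on one line.
  have hdich : ∀ t ∈ I, (∃ w ∈ box a h, w.im = t ∧ H i w < H j w ∧ H j' w < H i' w) ∨
      (∃ w ∈ box a h, w.im = t ∧ H i' w < H j' w ∧ H j w < H i w) := by
    intro t ht
    obtain ⟨x, hx, hx0⟩ := hT.exists_root i j hij t (hIh ht)
    obtain ⟨x', hx', hx0'⟩ := hT.exists_root i' j' hij' t (hIh ht)
    have hm := hT.strictMonoOn i j hij t (hIh ht)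
    have hm' := hT.strictMonoOn i' j' hij' t (hIh ht)
    have hxx' : x ≠ x' := by
      rintro rfl
      exact hne ⟨x, t⟩ (mem_box.2 ⟨hx, hIh ht⟩) ht hx0 hx0'
    have hmid : (x + x') / 2 ∈ Ioo (-a) a :=
      ⟨by linarith [hx.1, hx'.1], by linarith [hx.2, hx'.2]⟩
    have e1 := hm.lt_iff_lt hx hmid
    have e2 := hm.lt_iff_lt hmid hx
    have e3 := hm'.lt_iff_lt hx' hmid
    have e4 := hm'.lt_iff_lt hmid hx'
    simp only [hx0, hx0', sub_self, sub_pos, sub_neg] at e1 e2 e3 e4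
    rcases lt_or_gt_of_ne hxx' with hlt | hlt
    · exact Or.inl ⟨_, mem_box.2 ⟨hmid, hIh ht⟩, rfl, e1.2 (by linarith), e4.2 (by linarith)⟩
    · exact Or.inr ⟨_, mem_box.2 ⟨hmid, hIh ht⟩, rfl, e3.2 (by linarith), e2.2 (by linarith)⟩
  obtain ⟨t, ht, ⟨p, ⟨hp, hp1, hp2⟩, hpt⟩, ⟨q, ⟨hq, hq1, hq2⟩, hqt⟩⟩ :=
    hI _ _ (Complex.isOpenMap_im _ (hopen i j i' j')) (Complex.isOpenMap_im _ (hopen i' j' i j))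
      (fun t ht => by
        rcases hdich t ht with ⟨w, hw, rfl, hw'⟩ | ⟨w, hw, rfl, hw'⟩
        · exact Or.inl ⟨w, ⟨hw, hw'⟩, rfl⟩
        · exact Or.inr ⟨w, ⟨hw, hw'⟩, rfl⟩)
      ⟨z.im, hzI, z, ⟨hz, h1, h2⟩, rfl⟩
      ⟨y, hy, by
        rcases hdich y hy with ⟨w, hw, rfl, hw'⟩ | ⟨w, hw, rfl, hw'⟩
        · exact absurd ⟨w.re, (mem_box.1 hw).1, hw'⟩ hcon
        · exact ⟨w, ⟨hw, hw'⟩, rfl⟩⟩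
  have hth := hIh ht
  obtain ⟨hpa, -⟩ := mem_box.1 hp
  obtain ⟨hqa, -⟩ := mem_box.1 hq
  have hm := (hT.strictMonoOn i j hij t hth).lt_iff_lt hqa hpa
  have hm' := (hT.strictMonoOn i' j' hij' t hth).lt_iff_lt hpa hqa
  have ep : (⟨p.re, t⟩ : ℂ) = p := Complex.ext rfl hpt.symm
  have eq : (⟨q.re, t⟩ : ℂ) = q := Complex.ext rfl hqt.symm
  simp only [ep, eq] at hm hm'
  linarith [hm.1 (by linarith), hm'.1 (by linarith)]

/-- The value of a function that locally is one of the `H j` has the same index at any two points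
in the same cell, if their imaginary parts are in an interval that avoids `0`. -/
theorem IsTransverse.eq_of_same_cell (hT : IsTransverse H a h) {v : ℂ → ℝ}
    (hv : ∀ z ∈ box a h, (∀ i j, H i z = H j z → i = j) → ∃ j, ∀ᶠ w in 𝓝 z, v w = H j w)
    {I : Set ℝ} (hI : IsPreconnected I) (hIh : I ⊆ Ioo (-h) h) (hI0 : (0 : ℝ) ∉ I) {z : ℂ}
    (hz : z ∈ box a h) (hzI : z.im ∈ I) (hinj : ∀ i j, H i z = H j z → i = j) :
    (∀ y ∈ I, ∃ w ∈ cell H a h (fun i j => H j z - H i z), w.im = y) ∧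
    ∀ w ∈ cell H a h (fun i j => H j z - H i z), w.im ∈ I → ∀ j, v z = H j z → v w = H j w := by
  have hne0 : ∀ i j, i < j → H j z - H i z ≠ 0 := fun i j hij h0 =>
    hij.ne (hinj i j (sub_eq_zero.1 h0).symm)
  have h1 : ∀ y ∈ I, ∃ w ∈ cell H a h (fun i j => H j z - H i z), w.im = y := fun y hy =>
    hT.exists_mem_cell _ hne0 (hIh hy) fun i j hij i' j' hij' hpos hneg =>
      hT.exists_sep hI hIh hI0 hij hij' hz hzI (sub_pos.1 hpos) (sub_neg.1 hneg) hy
  refine ⟨h1, fun w hw hwI j hj => ?_⟩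
  exact hT.eq_of_mem_cell hv _ hI hIh h1
    ⟨hz, fun i j hij => mul_self_pos.2 (hne0 i j hij)⟩ hzI hw hwI hj

end IsTransverse

/-! ### Piecewise subharmonic functions and their index along horizontal lines -/

/-- An upper semicontinuous function with values among those of the `H j` that satisfies the
maximum principle with respect to each `H j`, and does not exceed its essential upper limits. -/
structure IsPiecewiseSubharmonic {k : ℕ} (v : ℂ → ℝ) (H : Fin k → ℂ → ℝ) (U : Set ℂ) : Prop where
  exists_eq : ∀ z ∈ U, ∃ j, v z = H j z
  eventually_lt : ∀ z ∈ U, ∀ c, v z < c → ∀ᶠ w in 𝓝 z, v w < c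
  le_of_ae_le : ∀ z ∈ U, ∀ f : ℂ → ℝ, ContinuousAt f z → ∀ N ∈ 𝓝 z,
    (∀ᵐ w, w ∈ N → v w ≤ f w) → v z ≤ f z
  eventually_eq : ∀ z ∈ U, ∀ j, v z = H j z → (∀ᶠ w in 𝓝 z, v w ≤ H j w) →
    ∀ᶠ w in 𝓝 z, v w = H j w

theorem IsSubharmonicConfiguration.isPiecewiseSubharmonic {k : ℕ} {V : ℂ → EReal}
    {H : Fin k → ℂ → ℝ} {Ω : TopologicalSpace.Opens ℂ} (hV : IsSubharmonicConfiguration V H Ω) :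
    IsPiecewiseSubharmonic (fun z => (V z).toReal) H Ω := by
  have hcoe : ∀ z ∈ Ω, V z = ((V z).toReal : EReal) := fun z hz => by
    obtain ⟨j, hj⟩ := hV.exists_eq hz
    rw [hj, EReal.toReal_coe]
  have hs := hV.memSH₀.subharmonicOn
  have hev : ∀ z ∈ Ω, ∀ᶠ w in 𝓝 z, w ∈ Ω := fun z hz => Ω.isOpen.mem_nhds hz
  refine ⟨fun z hz => ?_, fun z hz c hc => ?_, fun z hz f hf N hN hle => ?_,
    fun z hz j hj hle => ?_⟩
  · obtain ⟨j, hj⟩ := hV.exists_eq hz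
    exact ⟨j, by simp [hj]⟩
  · have hc' : V z < c := by rw [hcoe z hz]; exact_mod_cast hc
    have := hs.upperSemicontinuousOn z hz c hc'
    rw [nhdsWithin_eq_nhds.2 (Ω.isOpen.mem_nhds hz)] at this
    filter_upwards [this, hev z hz] with w hw hwΩ
    rw [hcoe w hwΩ] at hw
    exact_mod_cast hw
  · have := hs.le_of_ae_le hz hf (inter_mem hN (hev z hz)) (by
      filter_upwards [hle] with w hw hwN
      rw [hcoe w hwN.2]
      exact_mod_cast hw hwN.1)
    rw [hcoe z hz] at this
    exact_mod_cast this
  · have h1 := hs.eventually_eq_of_le hz (hV.harmonic j z hz)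
      (by rw [hcoe z hz]; exact_mod_cast hj) (by
        filter_upwards [hle, hev z hz] with w hw hwΩ
        rw [hcoe w hwΩ]
        exact_mod_cast hw)
    filter_upwards [h1] with w hw
    simp [hw]

theorem IsPiecewiseSubharmonic.mono {k : ℕ} {v : ℂ → ℝ} {H : Fin k → ℂ → ℝ} {U U' : Set ℂ}
    (hv : IsPiecewiseSubharmonic v H U) (hU : U' ⊆ U) : IsPiecewiseSubharmonic v H U' :=
  ⟨fun z hz => hv.1 z (hU hz), fun z hz => hv.2 z (hU hz), fun z hz => hv.3 z (hU hz),
    fun z hz => hv.4 z (hU hz)⟩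

section IsTransverse

variable {k : ℕ} {H : Fin k → ℂ → ℝ} {a h : ℝ}

/-- Fubini: each horizontal slice of the zero set has at most one point. -/
theorem IsTransverse.volume_eq_zero (hT : IsTransverse H a h) {i j : Fin k} (hij : i < j) :
    volume {z ∈ box a h | H j z = H i z} = 0 := by
  have hopen : IsOpen {z ∈ box a h | H j z ≠ H i z} := by
    rw [isOpen_iff_mem_nhds]
    rintro z ⟨hz, hne⟩
    filter_upwards [(isOpen_box a h).mem_nhds hz,
      (hT.continuousAt j hz).ne_iff_eventually_ne (hT.continuousAt i hz) |>.1 hne] with w h1 h2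
    exact ⟨h1, h2⟩
  have hm : MeasurableSet {z ∈ box a h | H j z = H i z} := by
    have : {z ∈ box a h | H j z = H i z} = box a h \ {z ∈ box a h | H j z ≠ H i z} := by
      ext z
      by_cases hz : z ∈ box a h <;> simp [hz]
    rw [this]
    exact (isOpen_box a h).measurableSet.diff hopen.measurableSet
  rw [← Complex.volume_preserving_equiv_real_prod.symm.measure_preimage hm.nullMeasurableSet,
    Measure.volume_eq_prod,
    Measure.prod_apply_symm (Complex.measurableEquivRealProd.symm.measurable hm)]
  refine lintegral_eq_zero_of_ae_eq_zero (Eventually.of_forall fun y => ?_)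
  refine Set.Subsingleton.measure_zero ?_ _
  rintro x ⟨hx, hx'⟩ x' ⟨hx1, hx1'⟩
  obtain ⟨h1, h2⟩ := mem_box.1 hx
  obtain ⟨h3, -⟩ := mem_box.1 hx1
  refine (hT.strictMonoOn i j hij y h2).injOn h1 h3 ?_
  exact (sub_eq_zero.2 hx').trans (sub_eq_zero.2 hx1').symm

theorem IsTransverse.ae_injective (hT : IsTransverse H a h) :
    ∀ᵐ z, z ∈ box a h → ∀ i j, H i z = H j z → i = j := by
  have h1 : ∀ᵐ z, ∀ i j, i < j → z ∈ box a h → H j z ≠ H i z := by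
    refine ae_all_iff.2 fun i => ae_all_iff.2 fun j => ?_
    by_cases hij : i < j
    · filter_upwards [measure_eq_zero_iff_ae_notMem.1 (hT.volume_eq_zero hij)] with z hz _ hzb heq
      exact hz ⟨hzb, heq⟩
    · exact Eventually.of_forall fun z h => absurd h hij
  filter_upwards [h1] with z hz hzb i j hij
  rcases lt_trichotomy i j with hlt | heq | hlt
  · exact absurd hij.symm (hz i j hlt hzb)
  · exact heq
  · exact absurd hij (hz j i hlt hzb)

theorem IsTransverse.eventually_injective_line (hT : IsTransverse H a h) {z : ℂ}
    (hz : z ∈ box a h) :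
    ∀ᶠ x in 𝓝[≠] z.re, ∀ i j, H i ⟨x, z.im⟩ = H j ⟨x, z.im⟩ → i = j := by
  obtain ⟨hza, hzh⟩ := mem_box.1 hz
  have h1 : ∀ᶠ x in 𝓝[≠] z.re, ∀ i j, i < j → H j ⟨x, z.im⟩ ≠ H i ⟨x, z.im⟩ := by
    refine eventually_all.2 fun i => eventually_all.2 fun j => ?_
    by_cases hij : i < j
    · by_cases heq : H j z = H i z
      · filter_upwards [self_mem_nhdsWithin, nhdsWithin_le_nhds (isOpen_Ioo.mem_nhds hza)]
          with x hx hxa _ hx'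
        refine hx ((hT.strictMonoOn i j hij _ hzh).injOn hxa hza ?_)
        simp [hx', heq]
      · have hc : ∀ ν, ContinuousAt (fun x => H ν ⟨x, z.im⟩) z.re := fun ν =>
          (hT.continuousOn_line ν hzh).continuousAt (isOpen_Ioo.mem_nhds hza)
        filter_upwards [nhdsWithin_le_nhds ((hc j).ne_iff_eventually_ne (hc i) |>.1 heq)]
          with x hx _ using hx
    · exact Eventually.of_forall fun z h => absurd h hij
  filter_upwards [h1] with x hx i j hij
  rcases lt_trichotomy i j with hlt | heq | hlt
  · exact absurd hij.symm (hx i j hlt)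
  · exact heq
  · exact absurd hij (hx j i hlt)

/-- Where the values `H i z` are distinct, semicontinuity excludes the larger ones near `z`. So `v ≤
H j` there with equality at `z`, and the maximum principle applies. -/
theorem IsPiecewiseSubharmonic.exists_eventually_eq {v : ℂ → ℝ}
    (hv : IsPiecewiseSubharmonic v H (box a h)) (hT : IsTransverse H a h) :
    ∀ z ∈ box a h, (∀ i j, H i z = H j z → i = j) → ∃ j, ∀ᶠ w in 𝓝 z, v w = H j w := by
  intro z hz hinj
  obtain ⟨j, hj⟩ := hv.exists_eq z hz
  refine ⟨j, hv.eventually_eq z hz j hj ?_⟩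
  have h1 : ∀ᶠ w in 𝓝 z, ∀ i, v w = H i w → H i w ≤ H j w := by
    refine eventually_all.2 fun i => ?_
    rcases lt_trichotomy (H i z) (H j z) with hlt | heq | hlt
    · filter_upwards [(hT.continuousAt i hz).eventually_lt (hT.continuousAt j hz) hlt] with w hw _
        using hw.le
    · rw [hinj i j heq]
      exact Eventually.of_forall fun _ _ => le_rfl
    · obtain ⟨c, hc1, hc2⟩ := exists_between hlt
      rw [← hj] at hc1
      filter_upwards [hv.eventually_lt z hz c hc1,
        (hT.continuousAt i hz).eventually (lt_mem_nhds hc2)] with w h2 h3 h4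
      exact absurd (h2.trans h3) (by simp [h4])
  filter_upwards [h1, (isOpen_box a h).mem_nhds hz] with w hw hwb
  obtain ⟨i, hi⟩ := hv.exists_eq w hwb
  exact hi ▸ hw i hi

end IsTransverse

/-- A function on an interval that near each point is equal to some `f α` on the left and to some
`f β` on the right, `α ≤ β`, where the differences `f j - f i`, `i < j`, are strictly increasing:
if it is `f j` to the right of `x₀`, then it majorizes `f j` and has an index at least `j` to the
right of every further point. -/
theorem le_of_germs {ι : Type*} [LinearOrder ι] {a : ℝ} {f : ι → ℝ → ℝ} {v : ℝ → ℝ}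
    (hf : ∀ j, ContinuousOn (f j) (Ioo (-a) a))
    (hmono : ∀ i j, i < j → StrictMonoOn (fun x => f j x - f i x) (Ioo (-a) a))
    (hgerm : ∀ x ∈ Ioo (-a) a, ∃ α β, α ≤ β ∧ v x = f α x ∧ v x = f β x ∧
      (∀ᶠ y in 𝓝[<] x, v y = f α y) ∧ ∀ᶠ y in 𝓝[>] x, v y = f β y)
    {x₀ x₁ : ℝ} {j : ι} (hx₀ : x₀ ∈ Ioo (-a) a) (hx₁ : x₁ ∈ Ioo (-a) a) (hle : x₀ ≤ x₁)
    (hv₀ : v x₀ = f j x₀) (hj : ∀ᶠ y in 𝓝[>] x₀, v y = f j y) :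
    f j x₁ ≤ v x₁ ∧ ∃ β, j ≤ β ∧ ∀ᶠ y in 𝓝[>] x₁, v y = f β y := by
  have huniq : ∀ l u : ℝ, l < u → Ioo l u ⊆ Ioo (-a) a → ∀ α β,
      (∀ y ∈ Ioo l u, v y = f α y) → (∀ y ∈ Ioo l u, v y = f β y) → α = β := by
    have key : ∀ l u : ℝ, l < u → Ioo l u ⊆ Ioo (-a) a → ∀ α β, α < β →
        (∀ y ∈ Ioo l u, v y = f α y) → (∀ y ∈ Ioo l u, v y = f β y) → False := by
      intro l u hlu hsub α β hαβ h1 h2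
      obtain ⟨p, hlp, hpu⟩ := exists_between hlu
      obtain ⟨q, hpq, hqu⟩ := exists_between hpu
      have hp : p ∈ Ioo l u := ⟨hlp, hpu⟩
      have hq : q ∈ Ioo l u := ⟨hlp.trans hpq, hqu⟩
      have := hmono α β hαβ (hsub hp) (hsub hq) hpq
      simp only [← h1 p hp, ← h1 q hq, ← h2 p hp, ← h2 q hq, sub_self, lt_irrefl] at this
    intro l u hlu hsub α β h1 h2
    rcases lt_trichotomy α β with hlt | heq | hlt
    · exact (key l u hlu hsub α β hlt h1 h2).elim
    · exact heq
    · exact (key l u hlu hsub β α hlt h2 h1).elim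
  have hR : ∀ x ∈ Ioo (-a) a, ∀ β, (∀ᶠ y in 𝓝[>] x, v y = f β y) →
      ∃ u, x < u ∧ Ioo x u ⊆ Ioo (-a) a ∧ ∀ y ∈ Ioo x u, v y = f β y := by
    intro x hx β hβ
    obtain ⟨u, hu, hsub⟩ := mem_nhdsGT_iff_exists_Ioo_subset.1
      (inter_mem hβ (mem_nhdsWithin_of_mem_nhds (isOpen_Ioo.mem_nhds hx)))
    exact ⟨u, hu, fun y hy => (hsub hy).2, fun y hy => (hsub hy).1⟩
  have hL : ∀ x ∈ Ioo (-a) a, ∀ β, (∀ᶠ y in 𝓝[<] x, v y = f β y) →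
      ∃ l, l < x ∧ Ioo l x ⊆ Ioo (-a) a ∧ ∀ y ∈ Ioo l x, v y = f β y := by
    intro x hx β hβ
    obtain ⟨u, hu, hsub⟩ := mem_nhdsLT_iff_exists_Ioo_subset.1
      (inter_mem hβ (mem_nhdsWithin_of_mem_nhds (isOpen_Ioo.mem_nhds hx)))
    exact ⟨u, hu, fun y hy => (hsub hy).2, fun y hy => (hsub hy).1⟩
  -- Continuous induction on `[x₀, x₁]`. Recording the index of the right germ together with the
  -- inequality makes the property propagate: to the right of `x` the difference `f β - f j` with `j
  -- ≤ β` does not decrease.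
  set s : Set ℝ := {x | f j x ≤ v x ∧ ∃ β, j ≤ β ∧ ∀ᶠ y in 𝓝[>] x, v y = f β y} with hs
  have hIcc : Icc x₀ x₁ ⊆ Ioo (-a) a := fun x hx =>
    ⟨hx₀.1.trans_le hx.1, hx.2.trans_lt hx₁.2⟩
  have hcont : ∀ i, ∀ x ∈ Ioo (-a) a, ContinuousAt (f i) x := fun i x hx =>
    (hf i).continuousAt (isOpen_Ioo.mem_nhds hx)
  -- the germ on an interval to either side belongs to every point of the interval
  have hgermI : ∀ l u : ℝ, Ioo l u ⊆ Ioo (-a) a → ∀ α, (∀ y ∈ Ioo l u, v y = f α y) →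
      ∀ y ∈ Ioo l u, y ∈ s → j ≤ α := by
    rintro l u hsub α hα y hy ⟨-, β, hjβ, hβ⟩
    obtain ⟨u', hu', -, hβ'⟩ := hR y (hsub hy) β hβ
    have hsub' : Ioo y (min u u') ⊆ Ioo l u := fun t ht =>
      ⟨hy.1.trans ht.1, ht.2.trans_le (min_le_left _ _)⟩
    rw [huniq y (min u u') (lt_min hy.2 hu') (hsub'.trans hsub) α β (fun t ht => hα t (hsub' ht))
      fun t ht => hβ' t ⟨ht.1, ht.2.trans_le (min_le_right _ _)⟩]
    exact hjβ
  suffices h : Icc x₀ x₁ ⊆ s from h (right_mem_Icc.2 hle)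
  refine IsClosed.Icc_subset_of_forall_exists_gt ?_ ⟨hv₀.ge, j, le_rfl, hj⟩ ?_
  · rw [isClosed_iff_frequently]
    intro x hx
    have hxI : x ∈ Icc x₀ x₁ := by
      by_contra hxI
      have hev : ∀ᶠ y in 𝓝 x, y ∈ (Icc x₀ x₁)ᶜ := isClosed_Icc.isOpen_compl.mem_nhds hxI
      exact hx (hev.mono fun y hy hy' => hy hy'.2)
    refine ⟨?_, hxI⟩
    have hxa := hIcc hxI
    obtain ⟨α, β, hαβ, hvα, hvβ, hα, hβ⟩ := hgerm x hxa
    have hx' : ∃ᶠ y in 𝓝 x, y ∈ s := hx.mono fun y hy => hy.1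
    -- Closedness: points of `s` accumulate at `x` from a side on which `v` is `f γ`. Their right
    -- germs have the same index, so `j ≤ γ ≤ β`, and `f j ≤ f γ` passes to the limit.
    have main : ∀ S : Set ℝ, ∀ γ, γ ≤ β → v x = f γ x →
        (∃ᶠ y in 𝓝[S] x, y ∈ s) → (∀ᶠ y in 𝓝[S] x, v y = f γ y) →
        (∀ᶠ y in 𝓝[S] x, y ∈ s → j ≤ γ) → x ∈ s := by
      intro S γ hγβ hvγ hfreq hev hjγ
      obtain ⟨y, hys, hy⟩ := (hfreq.and_eventually hjγ).exists
      refine ⟨?_, β, (hy hys).trans hγβ, hβ⟩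
      rw [hvγ]
      refine le_of_tendsto_of_tendsto_of_frequently
        ((hcont j x hxa).mono_left (nhdsWithin_le_nhds (s := S)))
        ((hcont γ x hxa).mono_left nhdsWithin_le_nhds) ?_
      exact (hfreq.and_eventually hev).mono fun y hy => hy.1.1.trans_eq hy.2
    rw [← nhdsNE_sup_pure, ← nhdsLT_sup_nhdsGT, frequently_sup, frequently_sup] at hx'
    rcases hx' with (hx' | hx') | hx'
    · obtain ⟨l, hl, hsub, hα'⟩ := hL x hxa α hα
      refine main _ α hαβ hvα hx' hα ?_
      filter_upwards [Ioo_mem_nhdsLT hl] with y hy using hgermI l x hsub α hα' y hy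
    · obtain ⟨u, hu, hsub, hβ'⟩ := hR x hxa β hβ
      refine main _ β le_rfl hvβ hx' hβ ?_
      filter_upwards [Ioo_mem_nhdsGT hu] with y hy using hgermI x u hsub β hβ' y hy
    · simpa [frequently_pure] using hx'
  · rintro x ⟨⟨hjx, β, hjβ, hβ⟩, hxI⟩ y hy
    have hxa := hIcc (Ico_subset_Icc_self hxI)
    obtain ⟨α, β', -, -, hvβ, -, hβ'⟩ := hgerm x hxa
    obtain ⟨u, hu, hsub, hβu⟩ := hR x hxa β hβ
    obtain ⟨u', hu', hsub', hβu'⟩ := hR x hxa β' hβ'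
    have hββ' : β = β' := huniq x (min u u') (lt_min hu hu')
      (fun t ht => hsub ⟨ht.1, ht.2.trans_le (min_le_left _ _)⟩) β β'
      (fun t ht => hβu t ⟨ht.1, ht.2.trans_le (min_le_left _ _)⟩)
      (fun t ht => hβu' t ⟨ht.1, ht.2.trans_le (min_le_right _ _)⟩)
    subst hββ'
    obtain ⟨t, ht1, ht2⟩ := exists_between (lt_min hu (mem_Ioi.1 hy))
    have htu : t ∈ Ioo x u := ⟨ht1, ht2.trans_le (min_le_left _ _)⟩
    refine ⟨t, ⟨?_, β, hjβ, ?_⟩, ht1, (ht2.trans_le (min_le_right _ _)).le⟩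
    · rw [hβu t htu]
      rcases hjβ.lt_or_eq with hlt | rfl
      · have := hmono j β hlt hxa (hsub htu) ht1
        simp only at this
        rw [hvβ] at hjx
        linarith
      · exact le_rfl
    · filter_upwards [Ioo_mem_nhdsGT htu.2] with r hr using hβu r ⟨htu.1.trans hr.1, hr.2⟩

section IsTransverse

variable {k : ℕ} {H : Fin k → ℂ → ℝ} {a h : ℝ}

theorem tendsto_mk_line (z : ℂ) : Tendsto (fun x : ℝ => (⟨x, z.im⟩ : ℂ)) (𝓝 z.re) (𝓝 z) := by
  simpa [ContinuousAt] using (continuous_mk_left z.im).continuousAt (x := z.re)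

/-- On a horizontal line off the real axis, the index of a piecewise subharmonic function does not
decrease from left to right across any point. -/
theorem IsPiecewiseSubharmonic.exists_germs {v : ℂ → ℝ}
    (hv : IsPiecewiseSubharmonic v H (box a h)) (hT : IsTransverse H a h) {I : Set ℝ}
    (hI : IsPreconnected I) (hIo : IsOpen I) (hIh : I ⊆ Ioo (-h) h) (hI0 : (0 : ℝ) ∉ I) {z : ℂ}
    (hz : z ∈ box a h) (hzI : z.im ∈ I) :
    ∃ α β, α ≤ β ∧ v z = H α z ∧ v z = H β z ∧
      (∀ᶠ x in 𝓝[<] z.re, v ⟨x, z.im⟩ = H α ⟨x, z.im⟩) ∧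
      ∀ᶠ x in 𝓝[>] z.re, v ⟨x, z.im⟩ = H β ⟨x, z.im⟩ := by
  have hloc := hv.exists_eventually_eq hT
  by_cases hinj : ∀ i j, H i z = H j z → i = j
  · obtain ⟨j, hj⟩ := hloc z hz hinj
    have h1 := (tendsto_mk_line z).eventually hj
    exact ⟨j, j, le_rfl, hj.self_of_nhds, hj.self_of_nhds, nhdsWithin_le_nhds h1,
      nhdsWithin_le_nhds h1⟩
  obtain ⟨i₀, j₀, hij₀, heq₀⟩ : ∃ i j, i < j ∧ H j z = H i z := by
    push Not at hinj
    obtain ⟨i, j, h1, h2⟩ := hinj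
    rcases lt_or_gt_of_ne h2 with h3 | h3
    · exact ⟨i, j, h3, h1.symm⟩
    · exact ⟨j, i, h3, h1⟩
  obtain ⟨hza, hzh⟩ := mem_box.1 hz
  have hz0 : z ≠ 0 := by
    rintro rfl
    exact hI0 (by simpa using hzI)
  -- Away from `0`, all zero curves through `z` coincide with that of the pair `i₀, j₀`, so near `z`
  -- there are just two cells, one on each side of it.
  have hsign : ∀ i j, i < j → H j z = H i z → ∀ w ∈ box a h,
      (H i₀ w < H j₀ w ↔ H i w < H j w) ∧ (H j₀ w < H i₀ w ↔ H j w < H i w) := by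
    intro i j hij heq w hw
    rcases hT.crossing i₀ j₀ hij₀ i j with hc | hc
    · exact hT.lt_iff_lt_of_zeros hij₀ hij hc hw
    · exact absurd heq (hc z hz hz0 heq₀)
  let E : ℂ → Prop := fun w => w ∈ box a h ∧ w.im ∈ I ∧
    ∀ i j, i < j → H j z ≠ H i z → 0 < (H j z - H i z) * (H j w - H i w)
  have hE : ∀ᶠ w in 𝓝 z, E w := by
    have hb : ∀ᶠ w in 𝓝 z, w ∈ box a h := (isOpen_box a h).mem_nhds hz
    refine hb.and
      ((Complex.continuous_im.continuousAt.eventually (hIo.mem_nhds hzI)).and ?_)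
    refine eventually_all.2 fun i => eventually_all.2 fun j => ?_
    by_cases hij : i < j ∧ H j z ≠ H i z
    · have hc : ContinuousAt (fun w => (H j z - H i z) * (H j w - H i w)) z :=
        continuousAt_const.mul ((hT.continuousAt j hz).sub (hT.continuousAt i hz))
      filter_upwards [hc.eventually (lt_mem_nhds (mul_self_pos.2 (sub_ne_zero.2 hij.2)))]
        with w hw _ _ using hw
    · exact Eventually.of_forall fun w h1 h2 => absurd ⟨h1, h2⟩ hij
  have hside : ∀ w₁ w₂, E w₁ → E w₂ →
      (H i₀ w₁ < H j₀ w₁ ∧ H i₀ w₂ < H j₀ w₂ ∨ H j₀ w₁ < H i₀ w₁ ∧ H j₀ w₂ < H i₀ w₂) →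
      w₂ ∈ cell H a h (fun i j => H j w₁ - H i w₁) := by
    intro w₁ w₂ h1 h2 h12
    refine ⟨h2.1, fun i j hij => ?_⟩
    by_cases heq : H j z = H i z
    · have e1 := hsign i j hij heq w₁ h1.1
      have e2 := hsign i j hij heq w₂ h2.1
      rcases h12 with ⟨h3, h4⟩ | ⟨h3, h4⟩
      · exact mul_pos (sub_pos.2 (e1.1.1 h3)) (sub_pos.2 (e2.1.1 h4))
      · exact mul_pos_of_neg_of_neg (sub_neg.2 (e1.2.1 h3)) (sub_neg.2 (e2.2.1 h4))
    · have e1 := h1.2.2 i j hij heq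
      have e2 := h2.2.2 i j hij heq
      rcases lt_or_gt_of_ne (sub_ne_zero.2 heq) with h3 | h3
      · exact mul_pos_of_neg_of_neg (neg_of_mul_pos_right e1 h3.le) (neg_of_mul_pos_right e2 h3.le)
      · exact mul_pos (pos_of_mul_pos_right e1 h3.le) (pos_of_mul_pos_right e2 h3.le)
  have hindex : ∀ w₁, E w₁ → (H i₀ w₁ < H j₀ w₁ ∨ H j₀ w₁ < H i₀ w₁) → ∃ γ, ∀ w₂, E w₂ →
      (H i₀ w₁ < H j₀ w₁ ∧ H i₀ w₂ < H j₀ w₂ ∨ H j₀ w₁ < H i₀ w₁ ∧ H j₀ w₂ < H i₀ w₂) →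
      v w₂ = H γ w₂ := by
    intro w₁ h1 h1'
    obtain ⟨γ, hγ⟩ := hv.exists_eq w₁ h1.1
    refine ⟨γ, fun w₂ h2 h12 => ?_⟩
    refine (hT.eq_of_same_cell hloc hI hIh hI0 h1.1 h1.2.1 ?_).2 w₂ (hside w₁ w₂ h1 h2 h12) h2.2.1
      γ hγ
    intro i j hij
    exact cell_injective (hside w₁ w₁ h1 h1 (by tauto)) hij
  have hElt : ∀ᶠ x in 𝓝[<] z.re, E ⟨x, z.im⟩ ∧ H j₀ ⟨x, z.im⟩ < H i₀ ⟨x, z.im⟩ := by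
    filter_upwards [nhdsWithin_le_nhds ((tendsto_mk_line z).eventually hE), self_mem_nhdsWithin]
      with x hx hxz
    refine ⟨hx, ?_⟩
    have := hT.strictMonoOn i₀ j₀ hij₀ _ hzh (mem_box.1 hx.1).1 hza hxz
    simp only [Complex.eta, heq₀, sub_self] at this
    linarith
  have hEgt : ∀ᶠ x in 𝓝[>] z.re, E ⟨x, z.im⟩ ∧ H i₀ ⟨x, z.im⟩ < H j₀ ⟨x, z.im⟩ := by
    filter_upwards [nhdsWithin_le_nhds ((tendsto_mk_line z).eventually hE), self_mem_nhdsWithin]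
      with x hx hxz
    refine ⟨hx, ?_⟩
    have := hT.strictMonoOn i₀ j₀ hij₀ _ hzh hza (mem_box.1 hx.1).1 hxz
    simp only [Complex.eta, heq₀, sub_self] at this
    linarith
  obtain ⟨x₁, hx₁, hx₁'⟩ := hElt.exists
  obtain ⟨x₂, hx₂, hx₂'⟩ := hEgt.exists
  obtain ⟨α, hα⟩ := hindex _ hx₁ (Or.inr hx₁')
  obtain ⟨β, hβ⟩ := hindex _ hx₂ (Or.inl hx₂')
  replace hα : ∀ w, E w → H j₀ w < H i₀ w → v w = H α w := fun w h1 h2 =>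
    hα w h1 (Or.inr ⟨hx₁', h2⟩)
  replace hβ : ∀ w, E w → H i₀ w < H j₀ w → v w = H β w := fun w h1 h2 =>
    hβ w h1 (Or.inl ⟨hx₂', h2⟩)
  have hleft : ∀ᶠ x in 𝓝[<] z.re, v ⟨x, z.im⟩ = H α ⟨x, z.im⟩ :=
    hElt.mono fun x hx => hα _ hx.1 hx.2
  have hright : ∀ᶠ x in 𝓝[>] z.re, v ⟨x, z.im⟩ = H β ⟨x, z.im⟩ :=
    hEgt.mono fun x hx => hβ _ hx.1 hx.2
  have htl : Tendsto (fun x : ℝ => (⟨x, z.im⟩ : ℂ)) (𝓝[<] z.re) (𝓝 z) :=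
    (tendsto_mk_line z).mono_left nhdsWithin_le_nhds
  have htr : Tendsto (fun x : ℝ => (⟨x, z.im⟩ : ℂ)) (𝓝[>] z.re) (𝓝 z) :=
    (tendsto_mk_line z).mono_left nhdsWithin_le_nhds
  -- The bound is clear off the curve, which is a null set; on the curve it follows from the
  -- essential bound `le_of_ae_le`.
  have hmax : ∀ᶠ w in 𝓝 z, v w ≤ max (H α w) (H β w) := by
    filter_upwards [hE.eventually_nhds] with w hw
    have hwb := hw.self_of_nhds.1
    refine hv.le_of_ae_le w hwb (fun w => max (H α w) (H β w))
      ((hT.continuousAt α hwb).max (hT.continuousAt β hwb)) _ hw ?_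
    filter_upwards [hT.ae_injective] with t ht htE
    rcases lt_trichotomy (H i₀ t) (H j₀ t) with h1 | h1 | h1
    · exact (hβ t htE h1).le.trans (le_max_right _ _)
    · exact absurd (ht htE.1 _ _ h1) hij₀.ne
    · exact (hα t htE h1).le.trans (le_max_left _ _)
  have hge : ∀ γ, ∀ l : Filter ℝ, l.NeBot → Tendsto (fun x : ℝ => (⟨x, z.im⟩ : ℂ)) l (𝓝 z) →
      (∀ᶠ x in l, v ⟨x, z.im⟩ = H γ ⟨x, z.im⟩) → H γ z ≤ v z := by
    intro γ l hl htend hev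
    by_contra! hlt
    obtain ⟨c, hc1, hc2⟩ := exists_between hlt
    obtain ⟨x, ⟨h1, h2⟩, h3⟩ := ((htend.eventually (hv.eventually_lt z hz c hc1)).and
      (htend.eventually ((hT.continuousAt γ hz).eventually (lt_mem_nhds hc2)))).and hev |>.exists
    linarith
  have hαz := hge α _ inferInstance htl hleft
  have hβz := hge β _ inferInstance htr hright
  have hmaxz := hmax.self_of_nhds
  -- If, say, `H α z < H β z`, then `v ≤ H β` near `z` with equality at `z`. The maximum principle
  -- would give `v = H β` on the left as well, where `v` is the smaller `H α`.
  have heq : H α z = H β z := by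
    rcases lt_trichotomy (H α z) (H β z) with hlt | heq | hlt
    · exfalso
      rw [max_eq_right hlt.le] at hmaxz
      have hlt' := (hT.continuousAt α hz).eventually_lt (hT.continuousAt β hz) hlt
      have h1 := hv.eventually_eq z hz β (le_antisymm hmaxz hβz) (by
        filter_upwards [hmax, hlt'] with w h1 h2
        rwa [max_eq_right h2.le] at h1)
      obtain ⟨x, ⟨h2, h3⟩, h4⟩ := ((htl.eventually h1).and (htl.eventually hlt')).and hleft |>.exists
      linarith
    · exact heq
    · exfalso
      rw [max_eq_left hlt.le] at hmaxz
      have hlt' := (hT.continuousAt β hz).eventually_lt (hT.continuousAt α hz) hlt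
      have h1 := hv.eventually_eq z hz α (le_antisymm hmaxz hαz) (by
        filter_upwards [hmax, hlt'] with w h1 h2
        rwa [max_eq_left h2.le] at h1)
      obtain ⟨x, ⟨h2, h3⟩, h4⟩ := ((htr.eventually h1).and (htr.eventually hlt')).and hright |>.exists
      linarith
  rw [heq, max_self] at hmaxz
  have hvβ : v z = H β z := le_antisymm hmaxz hβz
  -- If `β < α`, then near `z` the function `v` is at most `H α` and touches it at `z`, so it equals
  -- `H α` on both sides. On the right, however, it is `H β < H α`.
  refine ⟨α, β, not_lt.1 fun hβα => ?_, hvβ.trans heq.symm, hvβ, hleft, hright⟩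
  have hs := hsign β α hβα heq
  have h1 := hv.eventually_eq z hz α (hvβ.trans heq.symm) (by
    filter_upwards [hE, hmax] with w hw hwm
    rcases lt_trichotomy (H β w) (H α w) with h1 | h1 | h1
    · rwa [max_eq_left h1.le] at hwm
    · rwa [h1, max_self] at hwm
    · exact (hα w hw ((hs w hw.1).2.2 h1)).le)
  obtain ⟨x, ⟨h2, h3⟩, h4⟩ := ((htr.eventually h1).and hEgt).and hright |>.exists
  have h5 := (hs _ h3.1.1).1.1 h3.2
  linarith

end IsTransverse

/-! ### The maximum over the occurring indices, and part (a) -/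

section IsTransverse

variable {k : ℕ} {H : Fin k → ℂ → ℝ} {a h : ℝ}

theorem IsPiecewiseSubharmonic.le_right {v : ℂ → ℝ}
    (hv : IsPiecewiseSubharmonic v H (box a h)) (hT : IsTransverse H a h) {I : Set ℝ}
    (hI : IsPreconnected I) (hIo : IsOpen I) (hIh : I ⊆ Ioo (-h) h) (hI0 : (0 : ℝ) ∉ I) {z w : ℂ}
    (hz : z ∈ box a h) (hw : w ∈ box a h) (hzI : z.im ∈ I) (hwz : w.im = z.im)
    (hinj : ∀ i j, H i w = H j w → i = j) {j : Fin k} (hj : v w = H j w) (hre : w.re ≤ z.re) :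
    H j z ≤ v z ∧ ∃ β, j ≤ β ∧ ∀ᶠ x in 𝓝[>] z.re, v ⟨x, z.im⟩ = H β ⟨x, z.im⟩ := by
  obtain ⟨hza, hzh⟩ := mem_box.1 hz
  obtain ⟨i, hi⟩ := hv.exists_eventually_eq hT w hw hinj
  obtain rfl : j = i := hinj _ _ (hj.symm.trans hi.self_of_nhds)
  have hi' := (tendsto_mk_line w).eventually hi
  rw [hwz] at hi'
  have key := le_of_germs (f := fun i x => H i ⟨x, z.im⟩) (v := fun x => v ⟨x, z.im⟩) (j := j)
    (fun i => hT.continuousOn_line i hzh) (fun i j hij => hT.strictMonoOn i j hij _ hzh)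
    (fun x hx => hv.exists_germs hT hI hIo hIh hI0 (z := ⟨x, z.im⟩) (mem_box.2 ⟨hx, hzh⟩) hzI)
    (mem_box.1 hw).1 hza hre (by simpa [← hwz] using hj) (nhdsWithin_le_nhds hi')
  simpa using key

/-- The reflection `x ↦ -x` combined with the reversed order of the indices preserves the hypotheses
of `le_of_germs`. -/
theorem IsPiecewiseSubharmonic.le_left {v : ℂ → ℝ}
    (hv : IsPiecewiseSubharmonic v H (box a h)) (hT : IsTransverse H a h) {I : Set ℝ}
    (hI : IsPreconnected I) (hIo : IsOpen I) (hIh : I ⊆ Ioo (-h) h) (hI0 : (0 : ℝ) ∉ I) {z w : ℂ}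
    (hz : z ∈ box a h) (hw : w ∈ box a h) (hzI : z.im ∈ I) (hwz : w.im = z.im)
    (hinj : ∀ i j, H i w = H j w → i = j) {j : Fin k} (hj : v w = H j w) (hre : z.re ≤ w.re) :
    H j z ≤ v z := by
  obtain ⟨hza, hzh⟩ := mem_box.1 hz
  obtain ⟨hwa, -⟩ := mem_box.1 hw
  obtain ⟨i, hi⟩ := hv.exists_eventually_eq hT w hw hinj
  obtain rfl : j = i := hinj _ _ (hj.symm.trans hi.self_of_nhds)
  have hi' := (tendsto_mk_line w).eventually hi
  rw [hwz] at hi'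
  have hneg : MapsTo (fun x : ℝ => -x) (Ioo (-a) a) (Ioo (-a) a) := fun x hx =>
    ⟨by linarith [hx.2], by linarith [hx.1]⟩
  have hL : ∀ x : ℝ, Tendsto (fun x : ℝ => -x) (𝓝[<] x) (𝓝[>] (-x)) := fun x =>
    tendsto_neg_nhdsLT
  have hR : ∀ x : ℝ, Tendsto (fun x : ℝ => -x) (𝓝[>] x) (𝓝[<] (-x)) := fun x =>
    tendsto_neg_nhdsGT
  have key := le_of_germs (ι := (Fin k)ᵒᵈ) (a := a) (x₀ := -w.re) (x₁ := -z.re)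
    (f := fun i x => H (OrderDual.ofDual i) ⟨-x, z.im⟩)
    (v := fun x => v ⟨-x, z.im⟩) (j := OrderDual.toDual j)
    (fun i => (hT.continuousOn_line (OrderDual.ofDual i) hzh).comp continuous_neg.continuousOn hneg)
    (fun i j hij x hx y hy hxy => by
      have := hT.strictMonoOn (OrderDual.ofDual j) (OrderDual.ofDual i) hij _ hzh (hneg hy)
        (hneg hx) (neg_lt_neg hxy)
      simp only at this ⊢
      linarith)
    (fun x hx => by
      obtain ⟨α, β, h1, h2, h3, h4, h5⟩ := hv.exists_germs hT hI hIo hIh hI0 (z := ⟨-x, z.im⟩)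
        (mem_box.2 ⟨hneg hx, hzh⟩) hzI
      exact ⟨OrderDual.toDual β, OrderDual.toDual α, h1, h3, h2, (hL x).eventually h5,
        (hR x).eventually h4⟩)
    (hneg hwa) (hneg hza) (neg_le_neg hre) (by simpa [← hwz] using hj)
    ((hR (-w.re)).eventually (by
      rw [neg_neg]
      exact nhdsWithin_le_nhds hi'))
  simpa using key.1

theorem IsPiecewiseSubharmonic.index_le {v : ℂ → ℝ}
    (hv : IsPiecewiseSubharmonic v H (box a h)) (hT : IsTransverse H a h) {z w : ℂ}
    (hz : z ∈ box a h) (hw : w ∈ box a h) (hz0 : z.im ≠ 0) (hwz : w.im = z.im)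
    (hinj : ∀ i j, H i w = H j w → i = j) (hinj' : ∀ i j, H i z = H j z → i = j) {i j : Fin k}
    (hj : v w = H j w) (hi : v z = H i z) (hre : w.re ≤ z.re) : j ≤ i := by
  obtain ⟨I, hI, hIo, hIh, hI0, hzI⟩ : ∃ I : Set ℝ, IsPreconnected I ∧ IsOpen I ∧
      I ⊆ Ioo (-h) h ∧ (0 : ℝ) ∉ I ∧ z.im ∈ I := by
    obtain ⟨-, h1, h2⟩ := mem_box.1 hz
    have h0 := hT.pos_right
    rcases lt_or_gt_of_ne hz0 with h3 | h3
    · exact ⟨Ioo (-h) 0, isPreconnected_Ioo, isOpen_Ioo, Ioo_subset_Ioo_right h0.le, by simp,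
        h1, h3⟩
    · exact ⟨Ioo 0 h, isPreconnected_Ioo, isOpen_Ioo, Ioo_subset_Ioo_left (by linarith), by simp,
        h3, h2⟩
  obtain ⟨-, β, hjβ, hβ⟩ := hv.le_right hT hI hIo hIh hI0 hz hw hzI hwz hinj hj hre
  obtain ⟨i', hi'⟩ := hv.exists_eventually_eq hT z hz hinj'
  obtain rfl : i = i' := hinj' _ _ (hi.symm.trans hi'.self_of_nhds)
  have h1 : ∀ᶠ x in 𝓝[>] z.re, ∀ i j, H i ⟨x, z.im⟩ = H j ⟨x, z.im⟩ → i = j :=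
    nhdsWithin_mono _ (fun x (hx : z.re < x) => hx.ne') (hT.eventually_injective_line hz)
  have h2 : ∀ᶠ x in 𝓝[>] z.re, v ⟨x, z.im⟩ = H i ⟨x, z.im⟩ :=
    nhdsWithin_le_nhds ((tendsto_mk_line z).eventually hi')
  obtain ⟨x, ⟨h3, h4⟩, h5⟩ := (h1.and h2).and hβ |>.exists
  rwa [h3 _ _ (h4.symm.trans h5)]

/-- The indices that occur in a horizontal strip. -/
def activeIndices (v : ℂ → ℝ) (H : Fin k → ℂ → ℝ) (a h : ℝ) (I : Set ℝ) : Set (Fin k) :=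
  {j | ∃ z ∈ box a h, z.im ∈ I ∧ (∀ i j, H i z = H j z → i = j) ∧ v z = H j z}

/-- In a strip that avoids the real axis, a piecewise subharmonic function is the maximum of the
functions that occur in it. -/
theorem IsPiecewiseSubharmonic.isGreatest {v : ℂ → ℝ}
    (hv : IsPiecewiseSubharmonic v H (box a h)) (hT : IsTransverse H a h) {I : Set ℝ}
    (hI : IsPreconnected I) (hIo : IsOpen I) (hIh : I ⊆ Ioo (-h) h) (hI0 : (0 : ℝ) ∉ I) {z : ℂ}
    (hz : z ∈ box a h) (hzI : z.im ∈ I) :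
    IsGreatest ((fun j => H j z) '' activeIndices v H a h I) (v z) := by
  obtain ⟨hza, hzh⟩ := mem_box.1 hz
  constructor
  · obtain ⟨α, -, -, hα, -, hα', -⟩ := hv.exists_germs hT hI hIo hIh hI0 hz hzI
    refine ⟨α, ?_, hα.symm⟩
    have h1 : ∀ᶠ x in 𝓝[<] z.re, ∀ i j, H i ⟨x, z.im⟩ = H j ⟨x, z.im⟩ → i = j :=
      nhdsWithin_mono _ (fun x (hx : x < z.re) => hx.ne) (hT.eventually_injective_line hz)
    have h2 : ∀ᶠ x in 𝓝[<] z.re, x ∈ Ioo (-a) a :=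
      nhdsWithin_le_nhds (isOpen_Ioo.mem_nhds hza)
    obtain ⟨x, ⟨h3, h4⟩, h5⟩ := (h1.and h2).and hα' |>.exists
    exact ⟨⟨x, z.im⟩, mem_box.2 ⟨h4, hzh⟩, hzI, h3, h5⟩
  · rintro _ ⟨j, ⟨z', hz', hz'I, hinj, hj⟩, rfl⟩
    -- The cell in which `j` occurs reaches every horizontal line of the strip, so `j` occurs on the
    -- line of `z`, and propagation along that line applies.
    obtain ⟨h1, h2⟩ := hT.eq_of_same_cell (hv.exists_eventually_eq hT) hI hIh hI0 hz' hz'I hinj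
    obtain ⟨w, hw, hwz⟩ := h1 z.im hzI
    have hwj := h2 w hw (hwz ▸ hzI) j hj
    have hwinj : ∀ i j, H i w = H j w → i = j := fun i j => cell_injective hw
    rcases le_total w.re z.re with hre | hre
    · exact (hv.le_right hT hI hIo hIh hI0 hz hw.1 hzI hwz hwinj hwj hre).1
    · exact hv.le_left hT hI hIo hIh hI0 hz hw.1 hzI hwz hwinj hwj hre

/-- There are a smallest and a largest index off the real axis, and both occur on every
horizontal line. -/
theorem IsPiecewiseSubharmonic.exists_extreme {v : ℂ → ℝ}
    (hv : IsPiecewiseSubharmonic v H (box a h)) (hT : IsTransverse H a h) :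
    ∃ l r : Fin k,
      (∀ y ∈ Ioo (-h) h, l ∈ activeIndices v H a h {y} ∧ r ∈ activeIndices v H a h {y}) ∧
      ∀ z ∈ box a h, z.im ≠ 0 → (∀ i j, H i z = H j z → i = j) → ∀ i, v z = H i z →
        l ≤ i ∧ i ≤ r := by
  have hloc := hv.exists_eventually_eq hT
  -- With all signs equal no zeros need to be separated, so the leftmost and the rightmost cells
  -- meet every line, including the real axis. This ties the upper half to the lower one.
  have hneL : ∀ y ∈ Ioo (-h) h, ∃ z ∈ cell H a h (fun _ _ => -1), z.im = y := fun y hy =>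
    hT.exists_mem_cell _ (fun _ _ _ => by norm_num) hy fun i j _ i' j' _ h1 _ => by
      norm_num at h1
  have hneR : ∀ y ∈ Ioo (-h) h, ∃ z ∈ cell H a h (fun _ _ => 1), z.im = y := fun y hy =>
    hT.exists_mem_cell _ (fun _ _ _ => by norm_num) hy fun i j _ i' j' _ _ h1 => by
      norm_num at h1
  have h0 : (0 : ℝ) ∈ Ioo (-h) h := ⟨by linarith [hT.pos_right], hT.pos_right⟩
  obtain ⟨p, hp, hp0⟩ := hneL 0 h0
  obtain ⟨q, hq, hq0⟩ := hneR 0 h0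
  obtain ⟨l, hl⟩ := hv.exists_eq p hp.1
  obtain ⟨r, hr⟩ := hv.exists_eq q hq.1
  have hL : ∀ w ∈ cell H a h (fun _ _ => -1), v w = H l w := fun w hw =>
    hT.eq_of_mem_cell hloc _ isPreconnected_Ioo subset_rfl hneL hp (mem_box.1 hp.1).2 hw
      (mem_box.1 hw.1).2 hl
  have hR : ∀ w ∈ cell H a h (fun _ _ => 1), v w = H r w := fun w hw =>
    hT.eq_of_mem_cell hloc _ isPreconnected_Ioo subset_rfl hneR hq (mem_box.1 hq.1).2 hw
      (mem_box.1 hw.1).2 hr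
  refine ⟨l, r, fun y hy => ⟨?_, ?_⟩, fun z hz hz0 hinj i hi => ⟨?_, ?_⟩⟩
  · obtain ⟨z, hz, hzy⟩ := hneL y hy
    exact ⟨z, hz.1, hzy, fun _ _ => cell_injective hz, hL z hz⟩
  · obtain ⟨z, hz, hzy⟩ := hneR y hy
    exact ⟨z, hz.1, hzy, fun _ _ => cell_injective hz, hR z hz⟩
  · obtain ⟨hza, hzh⟩ := mem_box.1 hz
    obtain ⟨w, hw, hwz⟩ := hneL z.im hzh
    rcases le_or_gt w.re z.re with hre | hre
    · exact hv.index_le hT hz hw.1 hz0 hwz (fun _ _ => cell_injective hw) hinj (hL w hw) hi hre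
    -- A point to the left of a point of the leftmost cell is in that cell too.
    · refine (hinj _ _ ((hL z ⟨hz, fun i j hij => ?_⟩).symm.trans hi)).le
      have h1 := hT.strictMonoOn i j hij _ hzh hza (mem_box.1 hw.1).1 hre
      have h2 := hw.2 i j hij
      simp only [← hwz, Complex.eta] at h1
      rw [hwz, Complex.eta] at h1
      linarith
  · obtain ⟨hza, hzh⟩ := mem_box.1 hz
    obtain ⟨w, hw, hwz⟩ := hneR z.im hzh
    rcases le_or_gt z.re w.re with hre | hre
    · exact hv.index_le hT hw.1 hz (hwz ▸ hz0) hwz.symm hinj (fun _ _ => cell_injective hw) hi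
        (hR w hw) hre
    · refine (hinj _ _ (hi.symm.trans (hR z ⟨hz, fun i j hij => ?_⟩))).le
      have h1 := hT.strictMonoOn i j hij _ hzh (mem_box.1 hw.1).1 hza hre
      have h2 := hw.2 i j hij
      simp only [← hwz, Complex.eta] at h1
      rw [hwz, Complex.eta] at h1
      linarith

/-- Near a point around which `v = H i` there are points off the real axis with index `i`. -/
theorem IsTransverse.exists_im_ne_zero (hT : IsTransverse H a h) {v : ℂ → ℝ} {i : Fin k} {z : ℂ}
    (hz : z ∈ box a h) (hi : ∀ᶠ w in 𝓝 z, v w = H i w) :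
    ∃ w ∈ box a h, w.im ≠ 0 ∧ (∀ i j, H i w = H j w → i = j) ∧ v w = H i w := by
  have h0 : ∀ᶠ w in 𝓝 z, w ∈ box a h := (isOpen_box a h).mem_nhds hz
  have h1 : ∀ᶠ w in 𝓝 z, w ∈ box a h ∧ ∀ᶠ t in 𝓝 w, v t = H i t := h0.and hi.eventually_nhds
  -- A small vertical shift leaves the real axis; a small horizontal one then leaves all zero
  -- curves.
  have h2 : Tendsto (fun t : ℝ => (⟨z.re, t⟩ : ℂ)) (𝓝[≠] z.im) (𝓝 z) := by
    have := (continuous_mk_right z.re).continuousAt (x := z.im)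
    exact (by simpa [ContinuousAt] using this : Tendsto _ _ _).mono_left nhdsWithin_le_nhds
  have h3 : ∀ᶠ t in 𝓝[≠] z.im, t ≠ 0 := by
    rcases eq_or_ne z.im 0 with h0 | h0
    · rw [h0]
      exact self_mem_nhdsWithin
    · exact nhdsWithin_le_nhds (continuousAt_id.eventually_ne h0)
  obtain ⟨t, ⟨h4, h5⟩, h6⟩ := ((h2.eventually h1).and h3).exists
  obtain ⟨x, ⟨h7, h8⟩, h9⟩ := ((hT.eventually_injective_line h4).and (nhdsWithin_le_nhds
    (isOpen_Ioo.mem_nhds (mem_box.1 h4).1))).and (nhdsWithin_le_nhds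
    ((tendsto_mk_line _).eventually h5)) |>.exists
  exact ⟨⟨x, t⟩, mem_box.2 ⟨h8, (mem_box.1 h4).2⟩, h6, h7, h9⟩

end IsTransverse

theorem exists_index_sequence {k : ℕ} (hk : 2 ≤ k) (J : Set (Fin k)) {i₀ i₁ : Fin k}
    (hi₀ : (i₀ : ℕ) = 0) (hi₁ : (i₁ : ℕ) + 1 = k) (h0 : i₀ ∈ J) (h1 : i₁ ∈ J) :
    ∃ (m : ℕ) (j : Fin m → Fin k), IsIndexSequence j ∧ ∀ (H : Fin k → ℂ → ℝ) (z : ℂ) (t : ℝ),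
      IsGreatest ((fun j => H j z) '' J) t → t = maxAlong H j z := by
  classical
  set S : Finset (Fin k) := Finset.univ.filter (· ∈ J) with hS
  have hmem : ∀ i, i ∈ S ↔ i ∈ J := fun i => by simp [hS]
  have hrange : ∀ i, i ∈ J ↔ ∃ p, S.orderEmbOfFin rfl p = i := fun i => by
    rw [← hmem, ← Finset.mem_coe, ← Finset.range_orderEmbOfFin S rfl, mem_range]
  have hcard : 2 ≤ S.card := Finset.one_lt_card.2
    ⟨_, (hmem _).2 h0, _, (hmem _).2 h1, by rw [Ne, Fin.ext_iff]; omega⟩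
  refine ⟨S.card, S.orderEmbOfFin rfl, ⟨hcard, (S.orderEmbOfFin rfl).strictMono, ?_, ?_⟩, ?_⟩
  · intro i hi
    obtain ⟨p, hp⟩ := (hrange _).1 h0
    have : S.orderEmbOfFin rfl i ≤ S.orderEmbOfFin rfl p :=
      (S.orderEmbOfFin rfl).monotone (Fin.le_def.2 (by omega))
    rw [hp, Fin.le_def] at this
    omega
  · intro i hi
    obtain ⟨p, hp⟩ := (hrange _).1 h1
    have : S.orderEmbOfFin rfl p ≤ S.orderEmbOfFin rfl i :=
      (S.orderEmbOfFin rfl).monotone (Fin.le_def.2 (by omega))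
    rw [hp, Fin.le_def] at this
    have h2 := (S.orderEmbOfFin rfl i).2
    omega
  · rintro H z t ⟨⟨i, hi, rfl⟩, hub⟩
    have : Nonempty (Fin S.card) := ⟨⟨0, by omega⟩⟩
    refine le_antisymm ?_ (ciSup_le fun p => hub ⟨_, (hrange _).2 ⟨p, rfl⟩, rfl⟩)
    obtain ⟨p, rfl⟩ := (hrange _).1 hi
    exact le_ciSup (f := fun p => H (S.orderEmbOfFin rfl p) z) (Set.finite_range _).bddAbove p

theorem ball_subset_box {a h : ℝ} {δ : ℝ} (ha : δ ≤ a) (hh : δ ≤ h) : ball 0 δ ⊆ box a h := by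
  intro z hz
  rw [mem_ball_zero_iff] at hz
  exact mem_box.2 ⟨abs_lt.1 ((Complex.abs_re_le_norm z).trans_lt (hz.trans_le ha)),
    abs_lt.1 ((Complex.abs_im_le_norm z).trans_lt (hz.trans_le hh))⟩

theorem IsSubharmonicConfiguration.exists_eq_maxAlong {k : ℕ} (hk : 2 ≤ k) {R : ℝ} (hR : 0 < R)
    {H : Fin k → ℂ → ℝ} {b : Fin k → ℝ} (hH : ∀ ν, HarmonicOnNhd (H ν) (ball 0 R))
    (hH0 : ∀ ν, H ν 0 = 0) (hgrad : ∀ ν, HasGradientAt (H ν) ((b ν : ℝ) : ℂ) 0)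
    (hb : StrictMono b) {V : ℂ → EReal} (hV : IsSubharmonicConfiguration V H (disk R))
    {i₀ i₁ : Fin k} (hi₀ : (i₀ : ℕ) = 0) (hi₁ : (i₁ : ℕ) + 1 = k)
    (hfirst : (0 : ℂ) ∈ closure (activeSet V (H i₀) (disk R)))
    (hlast : (0 : ℂ) ∈ closure (activeSet V (H i₁) (disk R))) :
    ∃ (m n : ℕ) (jp : Fin m → Fin k) (jm : Fin n → Fin k) (δ : ℝ),
      IsIndexSequence jp ∧ IsIndexSequence jm ∧ 0 < δ ∧ δ ≤ R ∧
      (∀ z ∈ upperHalfDisk δ, V z = (maxAlong H jp z : EReal)) ∧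
      (∀ z ∈ lowerHalfDisk δ, V z = (maxAlong H jm z : EReal)) := by
  obtain ⟨a, h, hT, hbox⟩ := exists_isTransverse hR hH hH0 hgrad hb
  have ha := hT.pos_left
  have hh := hT.pos_right
  set v : ℂ → ℝ := fun z => (V z).toReal
  have hv : IsPiecewiseSubharmonic v H (box a h) := hV.isPiecewiseSubharmonic.mono hbox
  have hVv : ∀ z ∈ box a h, V z = (v z : EReal) := fun z hz => by
    obtain ⟨j, hj⟩ := hV.exists_eq (show z ∈ disk R from hbox hz)
    simp [v, hj]
  obtain ⟨l, r, hact, hext⟩ := hv.exists_extreme hT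
  have hbox0 : box a h ∈ 𝓝 (0 : ℂ) := (isOpen_box a h).mem_nhds
    (mem_box.2 ⟨by simp [ha], by simp [hh]⟩)
  have hpt : ∀ i, (0 : ℂ) ∈ closure (activeSet V (H i) (disk R)) → l ≤ i ∧ i ≤ r := by
    intro i hi
    obtain ⟨z, hzb, -, hz⟩ := mem_closure_iff_nhds.1 hi _ hbox0
    obtain ⟨w, hw, hw0, hinj, hwi⟩ := hT.exists_im_ne_zero (v := v) (i := i) hzb (by
      filter_upwards [hz] with w hw
      simp [v, hw])
    exact hext w hw hw0 hinj i hwi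
  -- The extreme indices of the tuple occur near `0`, so they lie between `l` and `r`.
  have hl : l = i₀ := le_antisymm (hpt _ hfirst).1 (Fin.le_def.2 (by omega))
  have hr : r = i₁ := le_antisymm (Fin.le_def.2 (by omega)) (hpt _ hlast).2
  have hactI : ∀ I : Set ℝ, ∀ y ∈ I, y ∈ Ioo (-h) h →
      i₀ ∈ activeIndices v H a h I ∧ i₁ ∈ activeIndices v H a h I := by
    intro I y hy hyh
    obtain ⟨⟨z, hz, hzy, hz'⟩, ⟨w, hw, hwy, hw'⟩⟩ := hact y hyh
    rw [mem_singleton_iff] at hzy hwy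
    rw [← hl, ← hr]
    exact ⟨⟨z, hz, hzy ▸ hy, hz'⟩, ⟨w, hw, hwy ▸ hy, hw'⟩⟩
  obtain ⟨hp0, hp1⟩ := hactI (Ioo 0 h) (h / 2) ⟨by linarith, by linarith⟩ ⟨by linarith, by linarith⟩
  obtain ⟨hm0, hm1⟩ := hactI (Ioo (-h) 0) (-(h / 2)) ⟨by linarith, by linarith⟩
    ⟨by linarith, by linarith⟩
  obtain ⟨m, jp, hjp, hmax⟩ := exists_index_sequence hk _ hi₀ hi₁ hp0 hp1
  obtain ⟨n, jm, hjm, hmax'⟩ := exists_index_sequence hk _ hi₀ hi₁ hm0 hm1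
  have hsub : ball (0 : ℂ) (min (min a h) R) ⊆ box a h :=
    ball_subset_box ((min_le_left _ _).trans (min_le_left _ _))
      ((min_le_left _ _).trans (min_le_right _ _))
  refine ⟨m, n, jp, jm, min (min a h) R, hjp, hjm, by positivity, min_le_right _ _, ?_, ?_⟩
  · rintro z ⟨hz, hz0⟩
    have hzb := hsub hz
    rw [hVv z hzb, hmax H z _ (hv.isGreatest hT isPreconnected_Ioo isOpen_Ioo
      (Ioo_subset_Ioo_left (by linarith)) (by simp) hzb ⟨hz0, (mem_box.1 hzb).2.2⟩)]
  · rintro z ⟨hz, hz0⟩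
    have hzb := hsub hz
    rw [hVv z hzb, hmax' H z _ (hv.isGreatest hT isPreconnected_Ioo isOpen_Ioo
      (Ioo_subset_Ioo_right hh.le) (by simp) hzb ⟨(mem_box.1 hzb).2.1, hz0⟩)]

/-! ### Distributional Laplacian and a minimum principle -/

open scoped ContDiff Convolution
theorem laplacian_eq_fderiv {f : ℂ → ℝ} {x : ℂ} (hf : ContDiffAt ℝ 2 f x) :
    Δ f x = fderiv ℝ (fun w => fderiv ℝ f w 1) x 1 +
      fderiv ℝ (fun w => fderiv ℝ f w Complex.I) x Complex.I := by
  have hd : DifferentiableAt ℝ (fderiv ℝ f) x :=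
    (hf.fderiv_right (m := 1) le_rfl).differentiableAt (by norm_num)
  have key : ∀ v : ℂ, fderiv ℝ (fun w => fderiv ℝ f w v) x v = fderiv ℝ (fderiv ℝ f) x v v := by
    intro v
    rw [fderiv_clm_apply hd (differentiableAt_const v)]
    simp
  rw [laplacian_eq_iteratedFDeriv_complexPlane, key, key]
  simp [iteratedFDeriv_two_apply]

theorem integrable_mul_of_tsupport_subset {f ψ : ℂ → ℝ} {U : Set ℂ} (hU : IsOpen U)
    (hf : ContinuousOn f U) (hψ : Continuous ψ) (hψc : HasCompactSupport ψ)
    (hψU : tsupport ψ ⊆ U) : Integrable (fun x => f x * ψ x) := by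
  have hc : Continuous fun x => f x * ψ x :=
    (hf.mul hψ.continuousOn).continuous_of_tsupport_subset hU
      ((tsupport_mul_subset_right (f := f) (g := ψ)).trans hψU)
  exact hc.integrable_of_hasCompactSupport hψc.mul_left

theorem contDiff_fderiv_apply {φ : ℂ → ℝ} (hφ : ContDiff ℝ ∞ φ) (v : ℂ) :
    ContDiff ℝ ∞ fun w => fderiv ℝ φ w v :=
  (hφ.fderiv_right (m := ∞) le_rfl).clm_apply contDiff_const

theorem tsupport_fderiv_apply_subset_tsupport (φ : ℂ → ℝ) (v : ℂ) :
    tsupport (fun w => fderiv ℝ φ w v) ⊆ tsupport φ :=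
  tsupport_fderiv_apply_subset ℝ v

/-- Two integrations by parts. Differentiability of `u` is needed only on the support of `φ`, so `u`
may be arbitrary outside `U`. -/
theorem integral_mul_fderiv_fderiv {u φ : ℂ → ℝ} {U : Set ℂ} (hU : IsOpen U)
    (hu : ∀ x ∈ U, ContDiffAt ℝ 2 u x) (hφ : ContDiff ℝ ∞ φ) (hφc : HasCompactSupport φ)
    (hφU : tsupport φ ⊆ U) (v : ℂ) :
    ∫ x, u x * fderiv ℝ (fun w => fderiv ℝ φ w v) x v =
      ∫ x, fderiv ℝ (fun w => fderiv ℝ u w v) x v * φ x := by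
  have hφ1 := contDiff_fderiv_apply hφ v
  have hφ2 := contDiff_fderiv_apply hφ1 v
  have hs1 := tsupport_fderiv_apply_subset_tsupport φ v
  have hs2 := tsupport_fderiv_apply_subset_tsupport (fun w => fderiv ℝ φ w v) v
  have hc1 : HasCompactSupport fun w => fderiv ℝ φ w v := hφc.fderiv_apply ℝ v
  have hc2 : HasCompactSupport fun w => fderiv ℝ (fun w => fderiv ℝ φ w v) w v :=
    hc1.fderiv_apply ℝ v
  have hu1 : ∀ x ∈ U, ContDiffAt ℝ 1 (fun w => fderiv ℝ u w v) x := fun x hx =>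
    ((hu x hx).fderiv_right (m := 1) le_rfl).clm_apply contDiffAt_const
  have hu2 : ∀ x ∈ U, ContDiffAt ℝ 0 (fun w => fderiv ℝ (fun w => fderiv ℝ u w v) w v) x :=
    fun x hx => ((hu1 x hx).fderiv_right (m := 0) le_rfl).clm_apply contDiffAt_const
  have cu : ContinuousOn u U := fun x hx => (hu x hx).continuousAt.continuousWithinAt
  have cu1 : ContinuousOn (fun w => fderiv ℝ u w v) U := fun x hx =>
    (hu1 x hx).continuousAt.continuousWithinAt
  have cu2 : ContinuousOn (fun w => fderiv ℝ (fun w => fderiv ℝ u w v) w v) U := fun x hx =>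
    (hu2 x hx).continuousAt.continuousWithinAt
  have hone : (1 : WithTop ℕ∞) ≠ 0 := one_ne_zero
  have htwo : (2 : WithTop ℕ∞) ≠ 0 := two_ne_zero
  have hinf : (∞ : WithTop ℕ∞) ≠ 0 := by simp
  rw [integral_mul_fderiv_eq_neg_fderiv_mul_of_integrable
      (integrable_mul_of_tsupport_subset hU cu1 hφ1.continuous hc1 (hs1.trans hφU))
      (integrable_mul_of_tsupport_subset hU cu hφ2.continuous hc2 ((hs2.trans hs1).trans hφU))
      (integrable_mul_of_tsupport_subset hU cu hφ1.continuous hc1 (hs1.trans hφU))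
      (fun x hx => (hu x (hφU (hs1 hx))).differentiableAt htwo)
      (fun x _ => hφ1.contDiffAt.differentiableAt hinf),
    integral_mul_fderiv_eq_neg_fderiv_mul_of_integrable
      (integrable_mul_of_tsupport_subset hU cu2 hφ.continuous hφc hφU)
      (integrable_mul_of_tsupport_subset hU cu1 hφ1.continuous hc1 (hs1.trans hφU))
      (integrable_mul_of_tsupport_subset hU cu1 hφ.continuous hφc hφU)
      (fun x hx => (hu1 x (hφU hx)).differentiableAt hone)
      (fun x _ => hφ.contDiffAt.differentiableAt hinf), neg_neg]

/-- A harmonic function has vanishing distributional Laplacian. -/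
theorem integral_mul_laplacian_eq_zero {u φ : ℂ → ℝ} {U : Set ℂ} (hU : IsOpen U)
    (hu : HarmonicOnNhd u U) (hφ : ContDiff ℝ ∞ φ) (hφc : HasCompactSupport φ)
    (hφU : tsupport φ ⊆ U) : ∫ x, u x * Δ φ x = 0 := by
  have hu' : ∀ x ∈ U, ContDiffAt ℝ 2 u x := fun x hx => (hu x hx).1
  have hint : ∀ v : ℂ, Integrable fun x => u x * fderiv ℝ (fun w => fderiv ℝ φ w v) x v := by
    intro v
    have h1 := contDiff_fderiv_apply (contDiff_fderiv_apply hφ v) v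
    refine integrable_mul_of_tsupport_subset hU
      (fun x hx => (hu' x hx).continuousAt.continuousWithinAt) h1.continuous
      ((hφc.fderiv_apply ℝ v).fderiv_apply ℝ v) ?_
    exact ((tsupport_fderiv_apply_subset_tsupport _ v).trans (tsupport_fderiv_apply_subset_tsupport φ v)).trans hφU
  have hint' : ∀ v : ℂ, Integrable fun x => fderiv ℝ (fun w => fderiv ℝ u w v) x v * φ x := by
    intro v
    refine integrable_mul_of_tsupport_subset hU (fun x hx => ?_) hφ.continuous hφc hφU
    have h1 : ContDiffAt ℝ 1 (fun w => fderiv ℝ u w v) x :=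
      ((hu' x hx).fderiv_right (m := 1) le_rfl).clm_apply contDiffAt_const
    have h2 : ContDiffAt ℝ 0 (fun w => fderiv ℝ (fun w => fderiv ℝ u w v) w v) x :=
      (h1.fderiv_right (m := 0) le_rfl).clm_apply contDiffAt_const
    exact h2.continuousAt.continuousWithinAt
  have h2 : (2 : WithTop ℕ∞) ≤ (∞ : WithTop ℕ∞) :=
    ENat.LEInfty.out
  have hΔφ : ∀ x, u x * Δ φ x = u x * fderiv ℝ (fun w => fderiv ℝ φ w 1) x 1 +
      u x * fderiv ℝ (fun w => fderiv ℝ φ w Complex.I) x Complex.I := fun x => by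
    rw [laplacian_eq_fderiv (hφ.contDiffAt.of_le h2), mul_add]
  simp_rw [hΔφ]
  rw [integral_add (hint 1) (hint Complex.I), integral_mul_fderiv_fderiv hU hu' hφ hφc hφU,
    integral_mul_fderiv_fderiv hU hu' hφ hφc hφU, ← integral_add (hint' 1) (hint' Complex.I)]
  refine integral_eq_zero_of_ae (Eventually.of_forall fun x => ?_)
  by_cases hx : x ∈ tsupport φ
  · have h3 := laplacian_eq_fderiv (hu' x (hφU hx))
    have h4 : Δ u x = 0 := (hu x (hφU hx)).2.self_of_nhds
    simp only [Pi.zero_apply]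
    rw [← add_mul, ← h3, h4, zero_mul]
  · simp [image_eq_zero_of_notMem_tsupport hx]

theorem laplacian_convolution {g φ : ℂ → ℝ} (hg : LocallyIntegrable g) (hφ : ContDiff ℝ ∞ φ)
    (hφc : HasCompactSupport φ) (x : ℂ) :
    Δ (g ⋆[ContinuousLinearMap.lsmul ℝ ℝ] φ) x = ∫ t, g t * Δ φ (x - t) := by
  have h2 : (2 : WithTop ℕ∞) ≤ (∞ : WithTop ℕ∞) :=
    ENat.LEInfty.out
  have h1 : (1 : WithTop ℕ∞) ≤ (∞ : WithTop ℕ∞) :=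
    ENat.LEInfty.out
  have hder : ∀ ψ : ℂ → ℝ, ContDiff ℝ ∞ ψ → HasCompactSupport ψ → ∀ v : ℂ,
      (fun y => fderiv ℝ (g ⋆[ContinuousLinearMap.lsmul ℝ ℝ] ψ) y v) =
        g ⋆[ContinuousLinearMap.lsmul ℝ ℝ] fun y => fderiv ℝ ψ y v := by
    intro ψ hψ hψc v
    funext y
    rw [(hψc.hasFDerivAt_convolution_right _ hg (hψ.of_le h1) y).fderiv,
      convolution_precompR_apply _ hg (hψc.fderiv ℝ)
        (hψ.continuous_fderiv (by simp))]
  have hC : ContDiff ℝ ∞ (g ⋆[ContinuousLinearMap.lsmul ℝ ℝ] φ) :=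
    hφc.contDiff_convolution_right _ hg hφ
  have hterm : ∀ v : ℂ,
      fderiv ℝ (fun w => fderiv ℝ (g ⋆[ContinuousLinearMap.lsmul ℝ ℝ] φ) w v) x v =
      ∫ t, g t * fderiv ℝ (fun w => fderiv ℝ φ w v) (x - t) v := by
    intro v
    rw [hder φ hφ hφc v]
    rw [congrFun (hder _ (contDiff_fderiv_apply hφ v) (hφc.fderiv_apply ℝ v) v) x]
    rfl
  have hint : ∀ v : ℂ,
      Integrable fun t => g t * fderiv ℝ (fun w => fderiv ℝ φ w v) (x - t) v := fun v =>
    HasCompactSupport.convolutionExists_right (ContinuousLinearMap.lsmul ℝ ℝ)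
      ((hφc.fderiv_apply ℝ v).fderiv_apply ℝ v) hg
      (contDiff_fderiv_apply (contDiff_fderiv_apply hφ v) v).continuous x
  rw [laplacian_eq_fderiv (hC.contDiffAt.of_le h2), hterm, hterm,
    ← integral_add (hint 1) (hint Complex.I)]
  congr 1
  funext t
  rw [laplacian_eq_fderiv (hφ.contDiffAt.of_le h2), mul_add]

theorem laplacian_comp_const_sub {φ : ℂ → ℝ} (hφ : ContDiff ℝ ∞ φ) (x t : ℂ) :
    Δ (fun s => φ (x - s)) t = Δ φ (x - t) := by
  have h2 : (2 : WithTop ℕ∞) ≤ (∞ : WithTop ℕ∞) :=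
    ENat.LEInfty.out
  have hder : ∀ ψ : ℂ → ℝ, ContDiff ℝ ∞ ψ → ∀ v : ℂ,
      (fun s => fderiv ℝ (fun s => ψ (x - s)) s v) = fun s => -fderiv ℝ ψ (x - s) v := by
    intro ψ hψ v
    funext s
    have h := (hψ.differentiable (by simp) (x - s)).hasFDerivAt.comp s
      ((hasFDerivAt_id (𝕜 := ℝ) s).const_sub x)
    have h' : fderiv ℝ (fun s => ψ (x - s)) s = _ := h.fderiv
    simp [h']
  have hterm : ∀ v : ℂ, fderiv ℝ (fun w => fderiv ℝ (fun s => φ (x - s)) w v) t v =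
      fderiv ℝ (fun w => fderiv ℝ φ w v) (x - t) v := by
    intro v
    rw [hder φ hφ v]
    have h := congrFun (hder _ (contDiff_fderiv_apply hφ v) v) t
    rw [fderiv_fun_neg, neg_apply, h, neg_neg]
  have hC : ContDiff ℝ ∞ fun s => φ (x - s) := hφ.comp (contDiff_const.sub contDiff_id)
  rw [laplacian_eq_fderiv (hC.contDiffAt.of_le h2), laplacian_eq_fderiv (hφ.contDiffAt.of_le h2),
    hterm, hterm]

/-- A continuous function whose distributional Laplacian vanishes satisfies the mean value
inequality `circleAverage w ≤ w z` up to an arbitrarily small error. -/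
theorem circleAverage_le_of_integral_laplacian_eq_zero {w : ℂ → ℝ} {z : ℂ} {ρ r : ℝ} (hr : 0 < r)
    (hrρ : r < ρ) (hw : ContinuousOn w (closedBall z ρ))
    (hΔ : ∀ φ : ℂ → ℝ, ContDiff ℝ ∞ φ → HasCompactSupport φ → tsupport φ ⊆ ball z ρ →
      ∫ x, w x * Δ φ x = 0) : Real.circleAverage w z r ≤ w z := by
  have hρ : 0 < ρ := hr.trans hrρ
  refine le_of_forall_pos_le_add fun η hη => ?_
  obtain ⟨d, hd, hdw⟩ := Metric.uniformContinuousOn_iff.1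
    ((isCompact_closedBall z ρ).uniformContinuousOn_of_continuous hw) (η / 2) (by positivity)
  -- The mollifier radius: `d` makes the smoothing uniformly close to `w`, and `e < ρ - r` keeps the
  -- translated kernels supported in `ball z ρ`.
  set e := min d ((ρ - r) / 2) with he
  have he0 : 0 < e := lt_min hd (by linarith)
  have heρ : e ≤ (ρ - r) / 2 := min_le_right _ _
  let B : ContDiffBump (0 : ℂ) := ⟨e / 2, e, by positivity, by linarith⟩
  set φ : ℂ → ℝ := B.normed volume with hφdef
  have hφ : ContDiff ℝ ∞ φ := B.contDiff_normed
  have hφc : HasCompactSupport φ := B.hasCompactSupport_normed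
  have hφs : tsupport φ = closedBall 0 e := B.tsupport_normed_eq
  set g : ℂ → ℝ := (closedBall z ρ).indicator w with hgdef
  have hgi : Integrable g := (hw.integrableOn_compact
    (isCompact_closedBall z ρ)).integrable_indicator isClosed_closedBall.measurableSet
  have hgw : ∀ x ∈ closedBall z ρ, g x = w x := fun x hx => indicator_of_mem hx w
  set u : ℂ → ℝ := g ⋆[ContinuousLinearMap.lsmul ℝ ℝ] φ with hu
  have hu' : u = φ ⋆[ContinuousLinearMap.lsmul ℝ ℝ] g := by
    funext x
    rw [hu, convolution_lsmul_swap, convolution_lsmul]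
    simp only [smul_eq_mul, mul_comm]
  have hclose : ∀ x ∈ closedBall z r, |u x - w x| ≤ η / 2 := by
    intro x hx
    have hxρ : x ∈ closedBall z ρ := closedBall_subset_closedBall hrρ.le hx
    have := ContDiffBump.dist_normed_convolution_le (φ := B) (μ := volume) (g := g) (x₀ := x)
      (ε := η / 2) hgi.aestronglyMeasurable (fun t ht => by
        have hxt : dist t x < e := ht
        have htρ : t ∈ closedBall z ρ := by
          rw [mem_closedBall] at hx ⊢
          linarith [dist_triangle t x z]
        rw [hgw t htρ, hgw x hxρ]
        exact (hdw t htρ x hxρ (hxt.trans_le (min_le_left _ _))).le)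
    rwa [← hφdef, ← hu', hgw x hxρ, Real.dist_eq] at this
  have hharm : HarmonicOnNhd u (closedBall z |r|) := by
    rw [abs_of_pos hr]
    intro x hx
    refine ⟨((hφc.contDiff_convolution_right _ hgi.locallyIntegrable hφ).contDiffAt).of_le
      (ENat.LEInfty.out), ?_⟩
    have hx' : x ∈ ball z (ρ - e) := by
      rw [mem_closedBall] at hx
      rw [mem_ball]
      linarith
    filter_upwards [isOpen_ball.mem_nhds hx'] with y hy
    rw [hu, laplacian_convolution hgi.locallyIntegrable hφ hφc y]
    have hψ : ContDiff ℝ ∞ fun s => φ (y - s) := hφ.comp (contDiff_const.sub contDiff_id)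
    have hψs : tsupport (fun s => φ (y - s)) ⊆ closedBall y e := by
      refine closure_minimal (fun s hs => ?_) isClosed_closedBall
      have h1 : y - s ∈ tsupport φ := subset_tsupport φ hs
      rw [hφs, mem_closedBall_zero_iff] at h1
      rwa [mem_closedBall, dist_comm, dist_eq_norm]
    have hψc : HasCompactSupport fun s => φ (y - s) :=
      (isCompact_closedBall y e).of_isClosed_subset (isClosed_tsupport _) hψs
    have hsub : closedBall y e ⊆ ball z ρ := by
      intro s hs
      rw [mem_closedBall] at hs
      rw [mem_ball] at hy ⊢
      linarith [dist_triangle s y z]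
    -- The Laplacian falls on the translated kernel, which is an admissible test function, so the
    -- smoothing is harmonic.
    rw [Pi.zero_apply, ← hΔ _ hψ hψc (hψs.trans hsub)]
    congr 1
    funext t
    rw [laplacian_comp_const_sub hφ]
    by_cases ht : t ∈ closedBall z ρ
    · rw [hgw t ht]
    · have h0 : Δ φ (y - t) = 0 := by
        have hnot : y - t ∉ tsupport φ := by
          rw [hφs]
          intro h1
          refine ht (ball_subset_closedBall (hsub ?_))
          rw [mem_closedBall_zero_iff] at h1
          rwa [mem_closedBall, dist_comm, dist_eq_norm]
        have h2 : φ =ᶠ[𝓝 (y - t)] fun _ => (0 : ℝ) := notMem_tsupport_iff_eventuallyEq.1 hnot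
        rw [laplacian_congr_nhds h2 |>.eq_of_nhds]
        simp
      rw [h0, mul_zero, mul_zero]
  have hsph : sphere z |r| ⊆ closedBall z |r| := sphere_subset_closedBall
  have hui : CircleIntegrable u z r := (hharm.continuousOn.mono hsph).circleIntegrable'
  have hwi : CircleIntegrable w z r := (hw.mono (by
    rw [abs_of_pos hr]
    exact sphere_subset_closedBall.trans (closedBall_subset_closedBall hrρ.le))).circleIntegrable'
  have h1 : Real.circleAverage w z r ≤ Real.circleAverage (u + fun _ => η / 2) z r := by
    refine Real.circleAverage_mono hwi (hui.add (circleIntegrable_const _ _ _)) fun x hx => ?_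
    have h2 := hclose x (by rw [← abs_of_pos hr]; exact hsph hx)
    have h3 := neg_le_of_abs_le h2
    simp only [Pi.add_apply]
    linarith
  rw [Real.circleAverage_add hui (circleIntegrable_const _ _ _), Real.circleAverage_const,
    InnerProductSpace.HarmonicOnNhd.circleAverage_eq hharm] at h1
  have h4 := le_of_abs_le (hclose z (mem_closedBall_self hr.le))
  linarith

/-- The minimum principle for continuous functions with vanishing distributional Laplacian. -/
theorem eventually_eq_zero_of_integral_laplacian_eq_zero {w : ℂ → ℝ} {z : ℂ} {ρ : ℝ} (hρ : 0 < ρ)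
    (hw : ContinuousOn w (closedBall z ρ)) (hw0 : ∀ x ∈ closedBall z ρ, 0 ≤ w x) (hwz : w z = 0)
    (hΔ : ∀ φ : ℂ → ℝ, ContDiff ℝ ∞ φ → HasCompactSupport φ → tsupport φ ⊆ ball z ρ →
      ∫ x, w x * Δ φ x = 0) : ∀ᶠ x in 𝓝 z, w x = 0 := by
  refine Metric.eventually_nhds_iff_ball.2 ⟨ρ, hρ, fun x hx => ?_⟩
  rcases eq_or_ne x z with rfl | hxz
  · exact hwz
  have hr : 0 < dist x z := dist_pos.2 hxz
  set r := dist x z with hrdef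
  have havg := circleAverage_le_of_integral_laplacian_eq_zero hr hx hw hΔ
  rw [hwz, Real.circleAverage_def, smul_eq_mul] at havg
  have hsph : ∀ t, circleMap z r t ∈ closedBall z ρ := fun t =>
    closedBall_subset_closedBall hx.le (circleMap_mem_closedBall z hr.le t)
  refine le_antisymm (not_lt.1 fun hpos => ?_) (hw0 x (ball_subset_closedBall hx))
  obtain ⟨t, ht, htx⟩ : x ∈ circleMap z r '' Ioc 0 (2 * Real.pi) := by
    rw [image_circleMap_Ioc, abs_of_pos hr]
    exact mem_sphere.2 rfl
  have hint : 0 < ∫ t in (0 : ℝ)..2 * Real.pi, w (circleMap z r t) := by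
    refine intervalIntegral.integral_pos (by positivity) ?_ (fun s _ => hw0 _ (hsph s))
      ⟨t, Ioc_subset_Icc_self ht, by rwa [htx]⟩
    exact hw.comp (continuous_circleMap z r).continuousOn fun s _ => hsph s
  have : 0 < (2 * Real.pi)⁻¹ * ∫ t in (0 : ℝ)..2 * Real.pi, w (circleMap z r t) :=
    mul_pos (by positivity) hint
  linarith

/-! ### Gluing two maxima, and part (b) -/

/-- A continuous function that near each point `z` majorizes one of the harmonic functions `H j`,
with equality at `z`. -/
structure IsSupported {k : ℕ} (v : ℂ → ℝ) (H : Fin k → ℂ → ℝ) (U : Set ℂ) : Prop where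
  continuousOn : ContinuousOn v U
  exists_le : ∀ z ∈ U, ∃ j, v z = H j z ∧ ∀ᶠ w in 𝓝 z, H j w ≤ v w

section IsTransverse

variable {k : ℕ} {H : Fin k → ℂ → ℝ} {a h : ℝ} {v : ℂ → ℝ} {Ω : TopologicalSpace.Opens ℂ}

/-- By continuity `v` avoids near `z` all `H i` with `i ≠ j`, and its values are among those of the
`H i`. -/
theorem IsSupported.eventually_eq (hv : IsSupported v H Ω) (hT : IsTransverse H a h)
    (hΩ : (Ω : Set ℂ) ⊆ box a h) {z : ℂ} (hz : z ∈ Ω) (hinj : ∀ i j, H i z = H j z → i = j)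
    {j : Fin k} (hj : v z = H j z) : ∀ᶠ w in 𝓝 z, v w = H j w := by
  have hΩz : ∀ᶠ w in 𝓝 z, w ∈ Ω := Ω.isOpen.mem_nhds hz
  have h1 : ∀ᶠ w in 𝓝 z, ∀ i, i ≠ j → v w ≠ H i w := by
    refine eventually_all.2 fun i => ?_
    by_cases hij : i = j
    · exact Eventually.of_forall fun w h => absurd hij h
    · have hne : v z ≠ H i z := fun h => hij (hinj _ _ (h.symm.trans hj))
      filter_upwards [((hv.continuousOn.continuousAt (Ω.isOpen.mem_nhds hz)).ne_iff_eventually_ne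
        (hT.continuousAt i (hΩ hz))).1 hne] with w hw _ using hw
  filter_upwards [h1, hΩz] with w hw hwΩ
  obtain ⟨i, hi, -⟩ := hv.exists_le w hwΩ
  by_cases hij : i = j
  · rwa [← hij]
  · exact absurd hi (hw i hij)

theorem notMem_laplacianSupport {u : ℂ → ℝ} {z : ℂ} (hu : HarmonicAt u z)
    (hvu : ∀ᶠ w in 𝓝 z, v w = u w) : z ∉ laplacianSupport (fun z => (v z : EReal)) Ω := by
  rintro ⟨hz, -⟩
  revert hz
  rw [imp_false, Distribution.notMem_dsupport_iff]
  obtain ⟨ε, hε, hεu⟩ := Metric.eventually_nhds_iff_ball.1 (hvu.and hu.eventually)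
  refine ⟨ball z ε, fun φ hφ => ?_, isOpen_ball, mem_ball_self hε⟩
  rw [laplacianFunctional, ← integral_mul_laplacian_eq_zero isOpen_ball
    (fun x hx => (hεu x hx).2) φ.contDiff φ.hasCompactSupport hφ]
  congr 1
  funext w
  by_cases hw : w ∈ tsupport (φ : ℂ → ℝ)
  · rw [EReal.toReal_coe, (hεu w (hφ hw)).1]
  · have h2 : (φ : ℂ → ℝ) =ᶠ[𝓝 w] fun _ => (0 : ℝ) := notMem_tsupport_iff_eventuallyEq.1 hw
    rw [laplacian_congr_nhds h2 |>.eq_of_nhds]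
    simp

/-- The difference `v - H j` is nonnegative near `z`, vanishes at `z` and has no Laplacian there, so
the minimum principle applies. This also covers points of a zero curve that are not in the support.
-/
theorem IsSupported.eventually_eq_of_notMem (hv : IsSupported v H Ω) (hT : IsTransverse H a h)
    (hΩ : (Ω : Set ℂ) ⊆ box a h) {z : ℂ}
    (hz : z ∈ (Ω : Set ℂ) \ laplacianSupport (fun z => (v z : EReal)) Ω) :
    ∃ j, ∀ᶠ w in 𝓝 z, v w = H j w := by
  obtain ⟨j, hj, hle⟩ := hv.exists_le z hz.1
  refine ⟨j, ?_⟩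
  have hz' : z ∉ Distribution.dsupport (laplacianFunctional (fun z => (v z : EReal)) Ω) :=
    fun h => hz.2 ⟨h, hz.1⟩
  rw [Distribution.notMem_dsupport_iff] at hz'
  obtain ⟨s, hs, hso, hzs⟩ := hz'
  obtain ⟨ε, hε, hεs⟩ := Metric.mem_nhds_iff.1
    (inter_mem (inter_mem (Ω.isOpen.mem_nhds hz.1) (hso.mem_nhds hzs)) hle)
  have hsub : closedBall z (ε / 2) ⊆ ball z ε := closedBall_subset_ball (by linarith)
  have hvc : ContinuousOn v (ball z ε) := hv.continuousOn.mono fun x hx => (hεs hx).1.1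
  have hHc : ContinuousOn (H j) (ball z ε) := fun x hx =>
    (hT.continuousAt j (hΩ (hεs hx).1.1)).continuousWithinAt
  have key := eventually_eq_zero_of_integral_laplacian_eq_zero (w := fun x => v x - H j x) (z := z)
    (ρ := ε / 2) (by positivity) ((hvc.sub hHc).mono hsub)
    (fun x hx => sub_nonneg.2 (hεs (hsub hx)).2) (by simp [hj]) ?_
  · filter_upwards [key] with w hw using sub_eq_zero.1 hw
  · intro φ hφ hφc hφs
    have hφε : tsupport φ ⊆ ball z ε := hφs.trans (ball_subset_closedBall.trans hsub)
    let ψ : 𝓓(Ω, ℝ) := ⟨φ, hφ, hφc, fun x hx => (hεs (hφε hx)).1.1⟩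
    have h1 : ∫ w, v w * Δ φ w = 0 := by
      have := hs ψ fun x hx => (hεs (hφε hx)).1.2
      simp only [laplacianFunctional, EReal.toReal_coe] at this
      exact this
    have h2 : ∫ w, H j w * Δ φ w = 0 := integral_mul_laplacian_eq_zero isOpen_ball
      (fun x hx => hT.harmonic j x (hΩ (hεs hx).1.1)) hφ hφc hφε
    have hcΔ : Continuous (Δ φ) := by
      have : Δ φ = fun x => fderiv ℝ (fun w => fderiv ℝ φ w 1) x 1 +
          fderiv ℝ (fun w => fderiv ℝ φ w Complex.I) x Complex.I := funext fun x =>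
        laplacian_eq_fderiv (hφ.contDiffAt.of_le ENat.LEInfty.out)
      rw [this]
      exact (contDiff_fderiv_apply (contDiff_fderiv_apply hφ 1) 1).continuous.add
        (contDiff_fderiv_apply (contDiff_fderiv_apply hφ Complex.I) Complex.I).continuous
    have hsΔ : tsupport (Δ φ) ⊆ tsupport φ := by
      refine closure_minimal (fun x hx => ?_) (isClosed_tsupport _)
      by_contra hnot
      have h2 : φ =ᶠ[𝓝 x] fun _ => (0 : ℝ) := notMem_tsupport_iff_eventuallyEq.1 hnot
      refine hx ?_
      rw [laplacian_congr_nhds h2 |>.eq_of_nhds]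
      simp
    have hΔc : HasCompactSupport (Δ φ) := hφc.of_isClosed_subset (isClosed_tsupport _) hsΔ
    simp_rw [sub_mul]
    rw [integral_sub
      (integrable_mul_of_tsupport_subset isOpen_ball hvc hcΔ hΔc (hsΔ.trans hφε))
      (integrable_mul_of_tsupport_subset isOpen_ball hHc hcΔ hΔc (hsΔ.trans hφε)), h1, h2, sub_zero]

/-- The touching function `H j` gives the submean inequality. The support lies in the null set of
zero curves, and off the support the local index is locally constant, hence constant on components.
-/
theorem IsSupported.isSubharmonicConfiguration (hv : IsSupported v H Ω) (hT : IsTransverse H a h)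
    (hΩ : (Ω : Set ℂ) ⊆ box a h) (hne : (Ω : Set ℂ).Nonempty) :
    IsSubharmonicConfiguration (fun z => (v z : EReal)) H Ω := by
  refine ⟨fun j z hz => hT.harmonic j z (hΩ hz), ⟨⟨?_, fun z _ => EReal.coe_ne_top _, ?_,
    hne.imp fun z hz => ⟨hz, EReal.coe_ne_bot _⟩⟩, ?_⟩, ?_⟩
  · exact (continuous_coe_real_ereal.comp_continuousOn hv.continuousOn).upperSemicontinuousOn
  · intro z hz
    obtain ⟨j, hj, hle⟩ := hv.exists_le z hz
    obtain ⟨ε, hε, hεs⟩ := Metric.mem_nhds_iff.1 (inter_mem (Ω.isOpen.mem_nhds hz) hle)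
    have hsub : closedBall z (ε / 2) ⊆ ball z ε := closedBall_subset_ball (by linarith)
    refine ⟨ε / 2, by positivity, fun x hx => (hεs (hsub hx)).1, fun r hr => ?_⟩
    have hrε : closedBall z |r| ⊆ ball z ε := by
      rw [abs_of_pos hr.1]
      exact (closedBall_subset_closedBall hr.2).trans hsub
    have hharm : HarmonicOnNhd (H j) (closedBall z |r|) := fun x hx =>
      hT.harmonic j x (hΩ (hεs (hrε hx)).1)
    have hi : CircleIntegrable (H j) z r :=
      (hharm.continuousOn.mono sphere_subset_closedBall).circleIntegrable'
    calc (v z : EReal) = circleMean (fun x => (H j x : EReal)) z r := by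
          rw [circleMean_coe hi, InnerProductSpace.HarmonicOnNhd.circleAverage_eq hharm, hj]
      _ ≤ _ := circleMean_mono (Eventually.of_forall fun t => by
          have := (hεs (hrε (sphere_subset_closedBall (circleMap_mem_sphere' z r t)))).2
          exact_mod_cast this)
  · rw [measure_eq_zero_iff_ae_notMem]
    filter_upwards [hT.ae_injective] with z hz hzs
    have hzΩ : z ∈ Ω := hzs.2
    obtain ⟨j, hj, -⟩ := hv.exists_le z hzΩ
    exact notMem_laplacianSupport (hT.harmonic j z (hΩ hzΩ))
      (hv.eventually_eq hT hΩ hzΩ (hz (hΩ hzΩ)) hj) hzs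
  · set S := (Ω : Set ℂ) \ laplacianSupport (fun z => (v z : EReal)) Ω with hS
    have hloc : ∀ z ∈ S, ∃ j, ∀ᶠ w in 𝓝 z, v w = H j w := fun z hz =>
      hv.eventually_eq_of_notMem hT hΩ hz
    intro z hz
    have : Nonempty (Fin k) := (hloc z hz).nonempty
    choose! ι hι using hloc
    -- Distinct `H i` cannot agree on an open set, because every open set has points off all zero
    -- curves.
    have huniq : ∀ w ∈ S, ∀ j, (∀ᶠ x in 𝓝 w, v x = H j x) → ι w = j := by
      intro w hw j hj
      obtain ⟨x, -, -, hinj, hx⟩ := hT.exists_im_ne_zero (v := H j) (i := ι w) (hΩ hw.1) (by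
        filter_upwards [hj, hι w hw] with x h1 h2
        rw [← h1, h2])
      exact hinj _ _ hx.symm
    let _ : TopologicalSpace (Fin k) := ⊥
    have : DiscreteTopology (Fin k) := ⟨rfl⟩
    have hsub := connectedComponentIn_subset S z
    have hc : ContinuousOn ι (connectedComponentIn S z) := by
      intro x hx
      rw [ContinuousWithinAt, nhds_discrete (Fin k), tendsto_pure]
      filter_upwards [nhdsWithin_le_nhds (hι x (hsub hx)).eventually_nhds, self_mem_nhdsWithin]
        with t ht htS using huniq t (hsub htS) _ ht
    refine ⟨ι z, fun w hw => ?_⟩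
    have h1 := isPreconnected_connectedComponentIn.constant hc hw (mem_connectedComponentIn hz)
    rw [← h1]
    exact_mod_cast (hι w (hsub hw)).self_of_nhds

theorem IsSupported.mem_activeSet (hv : IsSupported v H Ω) (hT : IsTransverse H a h)
    (hΩ : (Ω : Set ℂ) ⊆ box a h) {z : ℂ} (hz : z ∈ Ω) (hinj : ∀ i j, H i z = H j z → i = j)
    {j : Fin k} (hj : v z = H j z) : z ∈ activeSet (fun z => (v z : EReal)) (H j) Ω := by
  have h1 := hv.eventually_eq hT hΩ hz hinj hj
  refine ⟨⟨hz, notMem_laplacianSupport (hT.harmonic j z (hΩ hz)) h1⟩, ?_⟩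
  filter_upwards [h1] with w hw
  rw [hw]

theorem IsTransverse.lt_of_pos (hT : IsTransverse H a h) (hH0 : ∀ ν, H ν 0 = 0) {x : ℝ}
    (hx0 : 0 < x) (hx : x < a) {i j : Fin k} (hij : i < j) : H i (x : ℂ) < H j (x : ℂ) := by
  have h0 : (⟨0, 0⟩ : ℂ) = 0 := rfl
  have := hT.strictMonoOn i j hij 0 ⟨by linarith [hT.pos_right], hT.pos_right⟩
    (show (0 : ℝ) ∈ Ioo (-a) a from ⟨by linarith, by linarith⟩)
    (show x ∈ Ioo (-a) a from ⟨by linarith, hx⟩) hx0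
  simp only [h0, hH0, sub_self, sub_pos] at this
  exact this

theorem IsTransverse.lt_of_neg (hT : IsTransverse H a h) (hH0 : ∀ ν, H ν 0 = 0) {x : ℝ}
    (hx0 : x < 0) (hx : -a < x) {i j : Fin k} (hij : i < j) : H j (x : ℂ) < H i (x : ℂ) := by
  have h0 : (⟨0, 0⟩ : ℂ) = 0 := rfl
  have := hT.strictMonoOn i j hij 0 ⟨by linarith [hT.pos_right], hT.pos_right⟩
    (show x ∈ Ioo (-a) a from ⟨hx, by linarith⟩)
    (show (0 : ℝ) ∈ Ioo (-a) a from ⟨by linarith, by linarith⟩) hx0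
  simp only [h0, hH0, sub_self, sub_neg] at this
  exact this

theorem le_maxAlong {m : ℕ} (H : Fin k → ℂ → ℝ) (j : Fin m → Fin k) (i : Fin m) (z : ℂ) :
    H (j i) z ≤ maxAlong H j z :=
  le_ciSup (f := fun i => H (j i) z) (Set.finite_range _).bddAbove i

theorem exists_eq_maxAlong_apply {m : ℕ} [Nonempty (Fin m)] (H : Fin k → ℂ → ℝ)
    (j : Fin m → Fin k) (z : ℂ) : ∃ i, maxAlong H j z = H (j i) z := by
  obtain ⟨i, hi⟩ := exists_eq_ciSup_of_finite (f := fun i => H (j i) z)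
  exact ⟨i, hi.symm⟩

theorem continuousAt_maxAlong {m : ℕ} [Nonempty (Fin m)] {j : Fin m → Fin k} {z : ℂ}
    (hc : ∀ i, ContinuousAt (H i) z) : ContinuousAt (maxAlong H j) z := by
  have : maxAlong H j = fun z => Finset.univ.sup' Finset.univ_nonempty fun i => H (j i) z := by
    funext w
    rw [Finset.sup'_univ_eq_ciSup]
    rfl
  rw [this]
  exact ContinuousAt.finset_sup'_apply _ fun i _ => hc _

/-- A sequence that contains the extreme indices attains its maximum there on the real axis. -/
theorem IsTransverse.maxAlong_ofReal (hT : IsTransverse H a h) (hH0 : ∀ ν, H ν 0 = 0) {m : ℕ}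
    {j : Fin m → Fin k} {p q : Fin m} (hp : ∀ i, j p ≤ i) (hq : ∀ i, i ≤ j q) {x : ℝ}
    (hx : x ∈ Ioo (-a) a) :
    (x ≤ 0 → maxAlong H j x = H (j p) x) ∧ (0 ≤ x → maxAlong H j x = H (j q) x) := by
  have : Nonempty (Fin m) := ⟨p⟩
  constructor <;> intro hx0
  · refine le_antisymm (ciSup_le fun i => ?_) (le_maxAlong H j p _)
    rcases hx0.lt_or_eq with hlt | rfl
    · rcases (hp (j i)).lt_or_eq with h1 | h1
      · exact (hT.lt_of_neg hH0 hlt hx.1 h1).le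
      · rw [h1]
    · simp [hH0]
  · refine le_antisymm (ciSup_le fun i => ?_) (le_maxAlong H j q _)
    rcases hx0.lt_or_eq with hlt | rfl
    · rcases (hq (j i)).lt_or_eq with h1 | h1
      · exact (hT.lt_of_pos hH0 hlt hx.2 h1).le
      · rw [h1]
    · simp [hH0]

/-- Two maxima with the same extreme terms, glued along the real axis. -/
theorem IsTransverse.isSupported_ite (hT : IsTransverse H a h) (hH0 : ∀ ν, H ν 0 = 0)
    (hΩ : (Ω : Set ℂ) ⊆ box a h) {m n : ℕ} {jp : Fin m → Fin k} {jm : Fin n → Fin k}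
    {p q : Fin m} {p' q' : Fin n} (hp : ∀ i, jp p ≤ i) (hq : ∀ i, i ≤ jp q)
    (hp' : ∀ i, jm p' ≤ i) (hq' : ∀ i, i ≤ jm q') :
    IsSupported (fun z => if 0 ≤ z.im then maxAlong H jp z else maxAlong H jm z) H Ω := by
  have : Nonempty (Fin m) := ⟨p⟩
  have : Nonempty (Fin n) := ⟨p'⟩
  have hpp : jp p = jm p' := le_antisymm (hp _) (hp' _)
  have hqq : jp q = jm q' := le_antisymm (hq' _) (hq _)
  have hreal : ∀ z ∈ box a h, z.im = 0 → z = (z.re : ℂ) ∧ z.re ∈ Ioo (-a) a := fun z hz h0 =>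
    ⟨Complex.ext rfl (by simpa using h0), (mem_box.1 hz).1⟩
  have hcp : ∀ z ∈ Ω, ContinuousAt (maxAlong H jp) z := fun z hz =>
    continuousAt_maxAlong fun i => hT.continuousAt i (hΩ hz)
  have hcm : ∀ z ∈ Ω, ContinuousAt (maxAlong H jm) z := fun z hz =>
    continuousAt_maxAlong fun i => hT.continuousAt i (hΩ hz)
  have him : ∀ z : ℂ, ContinuousAt Complex.im z := fun z => Complex.continuous_im.continuousAt
  constructor
  · intro z hz
    refine ContinuousAt.continuousWithinAt ?_
    rcases lt_trichotomy z.im 0 with h0 | h0 | h0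
    · refine (hcm z hz).congr ?_
      filter_upwards [(him z).eventually (gt_mem_nhds h0)] with w hw
      rw [if_neg (not_le.2 hw)]
    · obtain ⟨hzr, hza⟩ := hreal z (hΩ hz) h0
      -- On the real axis only the extreme terms count, and the two sequences share them.
      have heq : maxAlong H jp z = maxAlong H jm z := by
        have h1 := hT.maxAlong_ofReal hH0 hp hq hza
        have h2 := hT.maxAlong_ofReal hH0 hp' hq' hza
        rw [← hzr] at h1 h2
        rcases le_total z.re 0 with h3 | h3
        · rw [h1.1 h3, h2.1 h3, hpp]
        · rw [h1.2 h3, h2.2 h3, hqq]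
      have h4 : Tendsto (maxAlong H jm) (𝓝 z) (𝓝 (maxAlong H jp z)) := heq ▸ hcm z hz
      simp only [ContinuousAt, h0, le_refl, if_true]
      exact (hcp z hz).if' h4
    · refine (hcp z hz).congr ?_
      filter_upwards [(him z).eventually (lt_mem_nhds h0)] with w hw
      rw [if_pos hw.le]
  · intro z hz
    rcases lt_trichotomy z.im 0 with h0 | h0 | h0
    · obtain ⟨i, hi⟩ := exists_eq_maxAlong_apply H jm z
      refine ⟨jm i, by rw [if_neg (not_le.2 h0), hi], ?_⟩
      filter_upwards [(him z).eventually (gt_mem_nhds h0)] with w hw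
      rw [if_neg (not_le.2 hw)]
      exact le_maxAlong _ _ _ _
    · obtain ⟨hzr, hza⟩ := hreal z (hΩ hz) h0
      have h1 := hT.maxAlong_ofReal hH0 hp hq hza
      rw [← hzr] at h1
      rcases le_total z.re 0 with h3 | h3
      · refine ⟨jp p, by rw [if_pos h0.ge, h1.1 h3], Eventually.of_forall fun w => ?_⟩
        split_ifs
        · exact le_maxAlong _ _ _ _
        · rw [hpp]
          exact le_maxAlong _ _ _ _
      · refine ⟨jp q, by rw [if_pos h0.ge, h1.2 h3], Eventually.of_forall fun w => ?_⟩
        split_ifs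
        · exact le_maxAlong _ _ _ _
        · rw [hqq]
          exact le_maxAlong _ _ _ _
    · obtain ⟨i, hi⟩ := exists_eq_maxAlong_apply H jp z
      refine ⟨jp i, by rw [if_pos h0.le, hi], ?_⟩
      filter_upwards [(him z).eventually (lt_mem_nhds h0)] with w hw
      rw [if_pos hw.le]
      exact le_maxAlong _ _ _ _

end IsTransverse

theorem IsIndexSequence.exists_first_last {k m : ℕ} {j : Fin m → Fin k} (hj : IsIndexSequence j) :
    ∃ p q : Fin m, ((j p : ℕ) = 0 ∧ (j q : ℕ) + 1 = k) ∧ (∀ i, j p ≤ i) ∧ ∀ i, i ≤ j q := by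
  have h2 := hj.two_le
  have h0 := hj.first ⟨0, by omega⟩ rfl
  have h1 := hj.last ⟨m - 1, by omega⟩ (by simp only; omega)
  exact ⟨_, _, ⟨h0, h1⟩, fun i => Fin.le_def.2 (by omega), fun i => Fin.le_def.2 (by omega)⟩

theorem exists_isSubharmonicConfiguration {k : ℕ} {R : ℝ} (hR : 0 < R)
    {H : Fin k → ℂ → ℝ} {b : Fin k → ℝ} (hH : ∀ ν, HarmonicOnNhd (H ν) (ball 0 R))
    (hH0 : ∀ ν, H ν 0 = 0) (hgrad : ∀ ν, HasGradientAt (H ν) ((b ν : ℝ) : ℂ) 0)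
    (hb : StrictMono b) {m n : ℕ} {jp : Fin m → Fin k} {jm : Fin n → Fin k}
    (hjp : IsIndexSequence jp) (hjm : IsIndexSequence jm) {i₀ i₁ : Fin k}
    (hi₀ : (i₀ : ℕ) = 0) (hi₁ : (i₁ : ℕ) + 1 = k) :
    ∃ (δ : ℝ) (V : ℂ → EReal), 0 < δ ∧ δ ≤ R ∧
      IsSubharmonicConfiguration V H (disk δ) ∧
      (0 : ℂ) ∈ closure (activeSet V (H i₀) (disk δ)) ∧
      (0 : ℂ) ∈ closure (activeSet V (H i₁) (disk δ)) ∧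
      (∀ z ∈ upperHalfDisk δ, V z = (maxAlong H jp z : EReal)) ∧
      (∀ z ∈ lowerHalfDisk δ, V z = (maxAlong H jm z : EReal)) := by
  obtain ⟨a, h, hT, hbox⟩ := exists_isTransverse hR hH hH0 hgrad hb
  have ha := hT.pos_left
  have hh := hT.pos_right
  obtain ⟨p, q, ⟨hp0, hq1⟩, hp, hq⟩ := hjp.exists_first_last
  obtain ⟨p', q', -, hp', hq'⟩ := hjm.exists_first_last
  set δ := min (min a h) R with hδdef
  have hδ : 0 < δ := by positivity
  have hδa : δ ≤ a := (min_le_left _ _).trans (min_le_left _ _)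
  have hsub : (disk δ : Set ℂ) ⊆ box a h :=
    ball_subset_box hδa ((min_le_left _ _).trans (min_le_right _ _))
  set v : ℂ → ℝ := fun z => if 0 ≤ z.im then maxAlong H jp z else maxAlong H jm z with hvdef
  have hv : IsSupported v H (disk δ) := hT.isSupported_ite hH0 hsub hp hq hp' hq'
  have hmem : ∀ x : ℝ, |x| < δ → (x : ℂ) ∈ disk δ := fun x hx => by
    change (x : ℂ) ∈ ball (0 : ℂ) δ
    simpa using hx
  have hvx : ∀ x : ℝ, v x = maxAlong H jp x := fun x => if_pos (by simp)
  have hinj : ∀ x : ℝ, x ≠ 0 → |x| < δ → ∀ i j, H i (x : ℂ) = H j (x : ℂ) → i = j := by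
    intro x hx0 hx
    have hlt : ∀ i j, i < j → H i (x : ℂ) ≠ H j (x : ℂ) := by
      intro i j hij
      obtain ⟨hx1, hx2⟩ := abs_lt.1 (hx.trans_le hδa)
      rcases lt_or_gt_of_ne hx0 with h0 | h0
      · exact (hT.lt_of_neg hH0 h0 hx1 hij).ne'
      · exact (hT.lt_of_pos hH0 h0 hx2 hij).ne
    intro i j hij
    rcases lt_trichotomy i j with h1 | h1 | h1
    · exact absurd hij (hlt i j h1)
    · exact h1
    · exact absurd hij.symm (hlt j i h1)
  -- The sign `s = ±1` selects a half of the real axis. Its points other than `0` are off all zero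
  -- curves, so they lie in the active set and accumulate at `0`.
  have hclos : ∀ i : Fin k, ∀ s : ℝ, |s| = 1 → (∀ t ∈ Ioo 0 δ, v ((s * t : ℝ) : ℂ) =
      H i ((s * t : ℝ) : ℂ)) → (0 : ℂ) ∈ closure (activeSet (fun z => (v z : EReal)) (H i)
        (disk δ)) := by
    intro i s hs hi
    rw [Metric.mem_closure_iff]
    intro ε hε
    obtain ⟨t, ht0, ht⟩ := exists_between (lt_min hε hδ)
    have habs : |s * t| = t := by rw [abs_mul, hs, one_mul, abs_of_pos ht0]
    have htδ : |s * t| < δ := habs.trans_lt (ht.trans_le (min_le_right _ _))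
    have hne : s * t ≠ 0 := by
      rw [← abs_pos, habs]
      exact ht0
    refine ⟨((s * t : ℝ) : ℂ), hv.mem_activeSet hT hsub (hmem _ htδ) (hinj _ hne htδ)
      (hi t ⟨ht0, ht.trans_le (min_le_right _ _)⟩), ?_⟩
    rw [dist_zero_left, Complex.norm_real, Real.norm_eq_abs, habs]
    exact ht.trans_le (min_le_left _ _)
  have hjp0 : jp p = i₀ := Fin.ext (by omega)
  have hjq1 : jp q = i₁ := Fin.ext (by omega)
  refine ⟨δ, fun z => (v z : EReal), hδ, min_le_right _ _,
    hv.isSubharmonicConfiguration hT hsub ⟨0, mem_ball_self hδ⟩, ?_, ?_, ?_, ?_⟩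
  · refine hclos _ (-1) (by simp) fun t ht => ?_
    rw [hvx, ← hjp0]
    exact (hT.maxAlong_ofReal hH0 hp hq ⟨by linarith [ht.2], by linarith [ht.1]⟩).1
      (by linarith [ht.1])
  · refine hclos _ 1 (by simp) fun t ht => ?_
    rw [hvx, ← hjq1]
    exact (hT.maxAlong_ofReal hH0 hp hq ⟨by linarith [ht.1], by linarith [ht.2]⟩).2
      (by linarith [ht.1])
  · rintro z ⟨-, hz⟩
    simp only [hvdef, if_pos hz.le]
  · rintro z ⟨-, hz⟩
    simp only [hvdef, if_neg (not_le.2 hz)]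

end SubharmonicConfiguration

open SubharmonicConfiguration in
theorem mainTheorem8 (k : ℕ) (hk : 2 ≤ k) (R : ℝ) (hR : 0 < R)
    (H : Fin k → ℂ → ℝ) (b : Fin k → ℝ)
    (hH : ∀ ν, InnerProductSpace.HarmonicOnNhd (H ν) (ball 0 R))
    (hH0 : ∀ ν, H ν 0 = 0)
    (hgrad : ∀ ν, HasGradientAt (H ν) ((b ν : ℝ) : ℂ) 0)
    (hb : StrictMono b) :
    (∀ V : ℂ → EReal, IsSubharmonicConfiguration V H (disk R) →
      (0 : ℂ) ∈ closure (activeSet V (H ⟨0, by omega⟩) (disk R)) →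
      (0 : ℂ) ∈ closure (activeSet V (H ⟨k - 1, by omega⟩) (disk R)) →
      ∃ (m n : ℕ) (jp : Fin m → Fin k) (jm : Fin n → Fin k) (δ : ℝ),
        IsIndexSequence jp ∧ IsIndexSequence jm ∧ 0 < δ ∧ δ ≤ R ∧
        (∀ z ∈ upperHalfDisk δ, V z = (maxAlong H jp z : EReal)) ∧
        (∀ z ∈ lowerHalfDisk δ, V z = (maxAlong H jm z : EReal))) ∧
    (∀ (m n : ℕ) (jp : Fin m → Fin k) (jm : Fin n → Fin k),
      IsIndexSequence jp → IsIndexSequence jm →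
      ∃ (δ : ℝ) (V : ℂ → EReal), 0 < δ ∧ δ ≤ R ∧
        IsSubharmonicConfiguration V H (disk δ) ∧
        (0 : ℂ) ∈ closure (activeSet V (H ⟨0, by omega⟩) (disk δ)) ∧
        (0 : ℂ) ∈ closure (activeSet V (H ⟨k - 1, by omega⟩) (disk δ)) ∧
        (∀ z ∈ upperHalfDisk δ, V z = (maxAlong H jp z : EReal)) ∧
        (∀ z ∈ lowerHalfDisk δ, V z = (maxAlong H jm z : EReal))) := by
  have hk1 : k - 1 + 1 = k := by omega
  exact ⟨fun _ hV h0 h1 => hV.exists_eq_maxAlong hk hR hH hH0 hgrad hb rfl hk1 h0 h1,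
    fun _ _ _ _ hjp hjm =>
      exists_isSubharmonicConfiguration hR hH hH0 hgrad hb hjp hjm rfl hk1⟩
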